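/- Let $\mathcal{D}_2$ be the set of real symmetric $2\times 2$ matrices $x=\begin{pmatrix}x_{11}&x_{12}\\x_{12}&x_{22}\end{pmatrix}$ such that $x$ and $I-x$ are positive definite. Densities on $\mathcal{D}_2$ are taken with respect to $dx_{11}\,dx_{12}\,dx_{22}$, and $B(\cdot,\cdot)$ and $\Gamma$ are the Euler beta and gamma functions. For $a,b,c>0$ and $x\in\mathcal{D}_2$ let $$f_{a,b,c}(x)=\frac{(\det x)^{a-1}\,(\det(I-x))^{b-1}\,|x_{12}|^{2c-1}}{B(a,b)\,B(a+b,c)\,B(a+c,b+c)}$$ (where $|x_{12}|^{0}=1$ also for $x_{12}=0$). For a $\mathcal{D}_2$-valued random matrix $X$ consider the conditions $$X_{11},\quad X_{22}-\frac{X_{12}^2}{X_{11}},\quad \frac{X_{12}}{\sqrt{(1-X_{11})(X_{11}-X_{11}X_{22}+X_{12}^2)}}\quad\text{are independent,}\tag{2.1}$$ $$X_{22},\quad X_{11}-\frac{X_{12}^2}{X_{22}},\quad \frac{X_{12}}{\sqrt{(1-X_{22})(X_{22}-X_{11}X_{22}+X_{12}^2)}}\quad\text{are independent.}\tag{2.2}$$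 Theorem 4. (i) Let $X$ be a $\mathcal{D}_2$-valued random matrix with a density $f$ which is continuously differentiable and strictly positive on $\mathcal{D}_2$, and suppose that (2.1) and (2.2) hold. Then there are $a,b,c>0$ with $f=f_{a,b,c}$ on $\mathcal{D}_2$. (ii) If $f$ is only assumed to be continuously differentiable and strictly positive on $\{x\in\mathcal{D}_2: x_{12}\neq 0\}$, and (2.1) and (2.2) hold, then there are $a,b,c>0$ and $k,l>0$ with $k+l=2$ such that, on $\mathcal{D}_2$, $f=k\,f_{a,b,c}$ where $x_{12}>0$ and $f=l\,f_{a,b,c}$ where $x_{12}<0$. (iii) For all $a,b,c>0$ the function $f_{a,b,c}$ is a probability density on $\mathcal{D}_2$, and a random matrix with this density satisfies (2.1) and (2.2). This law is a matrix beta law $\beta_2(p,q)$ for some $p,q>\frac12$ if and only if $c=\frac12$, and $f_{a,b,1/2}$ is the density of $\beta_2(a+\frac12,b+\frac12)$. Here $\beta_2(p,q)$ is the law on $\mathcal{D}_2$ with density $(\det x)^{p-3/2}(\det(I-x))^{q-3/2}\,\Gamma_2(p+q)/(\Gamma_2(p)\Gamma_2(q))$, where $\Gamma_2(p)=\pi^{1/2}\,\Gamma(p)\,\Gamma(p-\frac12)$.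 -/

import Mathlib

open MeasureTheory ProbabilityTheory

namespace KshirsagarTan

/-- Real `2 × 2` matrices. -/
abbrev Mat2 : Type := Matrix (Fin 2) (Fin 2) ℝ

/-- Measurability of a matrix is measurability of its entries. -/
instance instMeasurableSpaceMat2 : MeasurableSpace Mat2 :=
  inferInstanceAs (MeasurableSpace (Fin 2 → Fin 2 → ℝ))

/-- The symmetric matrix with coordinates `u = (x₁₁, x₁₂, x₂₂)`. -/
def sym (u : ℝ × ℝ × ℝ) : Mat2 := !![u.1, u.2.1; u.2.1, u.2.2]

/-- `D₂`: the symmetric `2 × 2` matrices `x` with `x` and `1 - x` positive definite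
(`Matrix.PosDef` includes symmetry). -/
def D2 : Set Mat2 := {x | x.PosDef ∧ (1 - x).PosDef}

/-- Lebesgue measure `dx₁₁ dx₁₂ dx₂₂` on the space of symmetric `2 × 2` matrices, as a measure
on `Mat2` carried by the symmetric matrices. -/
noncomputable def symLebesgue : Measure Mat2 := Measure.map sym volume

/-- The measure on `D₂` with density `f` with respect to Lebesgue measure; the values of `f`
outside `D₂` play no role. -/
noncomputable def lawOnD2 (f : Mat2 → ℝ) : Measure Mat2 :=
  symLebesgue.withDensity (D2.indicator fun x => ENNReal.ofReal (f x))

/-- The function `f` of a symmetric matrix is continuously differentiable on the set `s` of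
symmetric matrices, as a function of the coordinates `(x₁₁, x₁₂, x₂₂)`. -/
def IsC1On (f : Mat2 → ℝ) (s : Set Mat2) : Prop :=
  ContDiffOn ℝ 1 (fun u => f (sym u)) (sym ⁻¹' s)

/-- The triplet `(x₁₁, x₂.₁, v₁)`. -/
noncomputable def triplet1 (x : Mat2) : Fin 3 → ℝ :=
  ![x 0 0,
    x 1 1 - x 0 1 ^ 2 / x 0 0,
    x 0 1 / √((1 - x 0 0) * (x 0 0 - x 0 0 * x 1 1 + x 0 1 ^ 2))]

/-- The triplet `(x₂₂, x₁.₂, v₂)`. -/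
noncomputable def triplet2 (x : Mat2) : Fin 3 → ℝ :=
  ![x 1 1,
    x 0 0 - x 0 1 ^ 2 / x 1 1,
    x 0 1 / √((1 - x 1 1) * (x 1 1 - x 0 0 * x 1 1 + x 0 1 ^ 2))]

/-- Both triplet independences: under the probability `μ` the three components of
`triplet1 X` are (mutually) independent, and so are those of `triplet2 X`. -/
def TripletIndep {Ω : Type*} [MeasurableSpace Ω] (μ : Measure Ω) (X : Ω → Mat2) : Prop :=
  iIndepFun (fun (i : Fin 3) (ω : Ω) => triplet1 (X ω) i) μ ∧
    iIndepFun (fun (i : Fin 3) (ω : Ω) => triplet2 (X ω) i) μ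

/-- The density `(det x)^(a-1) (det (1-x))^(b-1) |x₁₂|^(2c-1) / (B(a,b) B(a+b,c) B(a+c,b+c))`,
to be used for `x ∈ D₂`; `ProbabilityTheory.beta` is the Euler beta function. -/
noncomputable def familyDensity (a b c : ℝ) (x : Mat2) : ℝ :=
  x.det ^ (a - 1) * (1 - x).det ^ (b - 1) * |x 0 1| ^ (2 * c - 1) /
    (beta a b * beta (a + b) c * beta (a + c) (b + c))

/-- The Euler gamma function of dimension `n`. -/
noncomputable def multiGamma (n : ℕ) (p : ℝ) : ℝ :=
  Real.pi ^ ((n : ℝ) * ((n : ℝ) - 1) / 4) * ∏ i ∈ Finset.range n, Real.Gamma (p - (i : ℝ) / 2)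

/-- The density of the matrix beta law `β₂(p, q)` (for `p, q > 1/2`), to be used for `x ∈ D₂`. -/
noncomputable def matrixBetaDensity (p q : ℝ) (x : Mat2) : ℝ :=
  x.det ^ (p - 3 / 2) * (1 - x).det ^ (q - 3 / 2) /
    (multiGamma 2 p * multiGamma 2 q / multiGamma 2 (p + q))

end KshirsagarTan

/-!
The map `chart`, inverse to the first triplet `(s, t, v)`, identifies `D₂` with
`(0, 1)² × (-1, 1)`. It is a scaling of `x₁₂` followed by a translation of `x₂₂`, with Jacobian
`√(s (1 - s) (1 - t))`, and
`det x = s t`, `det (1 - x) = (1 - s) (1 - t) (1 - v²)`, `x₁₂² = v² s (1 - s) (1 - t)`.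
Hence a product of powers of these three quantities is a product density in `(s, t, v)`, with beta
factors (`jac_mul_powerDensity_chart`); this gives the normalizing constant and the independence of
the first triplet, and the exchange of `x₁₁` and `x₂₂` (`swapDiag`) gives the second one.

Conversely, averaging over small cubes turns the independence of a triplet into the separability
of the continuous density in the chart (`density_exchange`). Writing the logarithm of the density
through both triplets, `(s, t, v)` and `(s', t', v')`, with `w = v²` and `w' = v'²`, yields the
functional equation
`A₁(s) + A₂(t) + A₃(w) = B₁(s') + B₂(t') + B₃(w')` (`TripletEquation`).
By the three formulas above, `w` and `w'` are both constant along the curves on which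
`s' / s = t / t'` and `(1 - s) (1 - t) / ((1 - s') (1 - t'))` are constant. Differentiating along
them eliminates `A₃` and `B₃` (`TripletEquation.deriv_eq`). For a fixed ratio `κ = s' / s` the
resulting equation separates up to a constant `C(κ)`, and comparing poles in a scaling parameter
shows that `C(κ) = g (κ - 1)` (`LogDerivEquation.exists_solution`). So `A₁`, `A₂`, and then `A₃`,
are combinations of logarithms (`TripletEquation.exists_solution`), and the density is a product of
powers on each of the two halves `0 < x₁₂` and `x₁₂ < 0`, with common exponents. The total mass `1`
makes the beta integrals finite, hence the parameters positive, and fixes the sum of the weights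
of the halves. A density that is continuous and positive also where `x₁₂ = 0` must have
`c = 1 / 2` and equal weights.
-/

namespace KshirsagarTan

/-! ### The set `D₂` and the chart given by the first triplet -/

theorem posDef_sym_iff (u : ℝ × ℝ × ℝ) :
    (sym u).PosDef ↔ 0 < u.1 ∧ 0 < u.1 * u.2.2 - u.2.1 ^ 2 := by
  constructor
  · intro h
    have h1 := h.diag_pos (i := 0)
    have h2 := h.det_pos
    simp only [sym, Matrix.det_fin_two_of] at h1 h2
    exact ⟨by simpa using h1, by linarith⟩
  · rintro ⟨h1, h2⟩
    rw [Matrix.posDef_iff_dotProduct_mulVec]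
    refine ⟨?_, fun w hw => ?_⟩
    · ext i j
      fin_cases i <;> fin_cases j <;> simp [sym]
    -- complete the square in the first variable
    · have key : u.1 * (star w ⬝ᵥ Matrix.mulVec (sym u) w)
          = (u.1 * w 0 + u.2.1 * w 1) ^ 2 + (u.1 * u.2.2 - u.2.1 ^ 2) * w 1 ^ 2 := by
        simp [sym, dotProduct, Matrix.mulVec, Fin.sum_univ_two]
        ring
      have hpos : 0 < u.1 * (star w ⬝ᵥ Matrix.mulVec (sym u) w) := by
        rw [key]
        by_cases h : w 1 = 0
        · have h0 : w 0 ≠ 0 := by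
            intro h0
            apply hw
            ext i
            fin_cases i <;> simp [h, h0]
          simp only [h]
          have : 0 < (u.1 * w 0) ^ 2 := by positivity
          linarith
        · have : 0 < (u.1 * u.2.2 - u.2.1 ^ 2) * w 1 ^ 2 := by positivity
          nlinarith [sq_nonneg (u.1 * w 0 + u.2.1 * w 1)]
      exact (pos_iff_pos_of_mul_pos hpos).1 h1

theorem one_sub_sym (u : ℝ × ℝ × ℝ) : 1 - sym u = sym (1 - u.1, -u.2.1, 1 - u.2.2) := by
  ext i j
  fin_cases i <;> fin_cases j <;> simp [sym]

theorem sym_mem_D2_iff (u : ℝ × ℝ × ℝ) :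
    sym u ∈ D2 ↔ (0 < u.1 ∧ 0 < u.1 * u.2.2 - u.2.1 ^ 2) ∧
      (0 < 1 - u.1 ∧ 0 < (1 - u.1) * (1 - u.2.2) - u.2.1 ^ 2) := by
  have h : sym u ∈ D2 ↔ (sym u).PosDef ∧ (1 - sym u).PosDef := Iff.rfl
  rw [h, one_sub_sym, posDef_sym_iff, posDef_sym_iff]
  simp

theorem exists_eq_sym_of_mem_D2 {x : Mat2} (hx : x ∈ D2) : x = sym (x 0 0, x 0 1, x 1 1) := by
  have h : x 1 0 = x 0 1 := by simpa using hx.1.isHermitian.apply 0 1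
  ext i j
  fin_cases i <;> fin_cases j <;> simp [sym, h]

theorem det_sym (u : ℝ × ℝ × ℝ) : (sym u).det = u.1 * u.2.2 - u.2.1 ^ 2 := by
  simp [sym, Matrix.det_fin_two_of]; ring

theorem det_one_sub_sym (u : ℝ × ℝ × ℝ) :
    (1 - sym u).det = (1 - u.1) * (1 - u.2.2) - u.2.1 ^ 2 := by
  rw [one_sub_sym, det_sym]; ring

theorem measurable_sym : Measurable sym := by
  refine measurable_pi_lambda _ fun i => measurable_pi_lambda _ fun j => ?_
  fin_cases i <;> fin_cases j <;> simp [sym] <;> fun_prop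

theorem measurable_entry (i j : Fin 2) : Measurable fun x : Mat2 => x i j :=
  (measurable_pi_apply j).comp (measurable_pi_apply i)

theorem measurableEmbedding_sym : MeasurableEmbedding sym := by
  refine MeasurableEmbedding.of_measurable_inverse
    (g := fun x : Mat2 => (x 0 0, x 0 1, x 1 1)) measurable_sym ?_ ?_ ?_
  · have : Set.range sym = {x : Mat2 | x 0 1 = x 1 0} := by
      ext x
      constructor
      · rintro ⟨u, rfl⟩
        simp [sym]
      · intro h
        refine ⟨(x 0 0, x 0 1, x 1 1), ?_⟩
        have h' : x 0 1 = x 1 0 := h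
        ext i j
        fin_cases i <;> fin_cases j <;> simp [sym, h']
    rw [this]
    exact measurableSet_eq_fun (measurable_entry 0 1) (measurable_entry 1 0)
  · exact (measurable_entry 0 0).prodMk ((measurable_entry 0 1).prodMk (measurable_entry 1 1))
  · intro u
    simp [sym]

theorem isOpen_preimage_D2 : IsOpen (sym ⁻¹' D2) := by
  have : sym ⁻¹' D2 = {u : ℝ × ℝ × ℝ | (0 < u.1 ∧ 0 < u.1 * u.2.2 - u.2.1 ^ 2) ∧
      (0 < 1 - u.1 ∧ 0 < (1 - u.1) * (1 - u.2.2) - u.2.1 ^ 2)} := by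
    ext u; exact sym_mem_D2_iff u
  rw [this]
  have h : ∀ g : ℝ × ℝ × ℝ → ℝ, Continuous g → IsOpen {u | 0 < g u} := fun g hg =>
    isOpen_lt continuous_const hg
  exact ((h _ (by fun_prop)).inter (h _ (by fun_prop))).inter
    ((h (fun u => 1 - u.1) (by fun_prop)).inter (h _ (by fun_prop)))

/-- The symmetric matrices of `D₂` with nonzero off-diagonal entry, in coordinates. -/
def offDiag : Set (ℝ × ℝ × ℝ) := sym ⁻¹' {x | x ∈ D2 ∧ x 0 1 ≠ 0}

theorem mem_offDiag_iff (u : ℝ × ℝ × ℝ) : u ∈ offDiag ↔ sym u ∈ D2 ∧ u.2.1 ≠ 0 := by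
  simp [offDiag, sym]

theorem isOpen_offDiag : IsOpen offDiag := by
  have : offDiag = sym ⁻¹' D2 ∩ {u | u.2.1 ≠ 0} := by
    ext u; exact mem_offDiag_iff u
  rw [this]
  exact isOpen_preimage_D2.inter (isOpen_ne_fun (by fun_prop) (by fun_prop))

/-- The factor relating `x₁₂` to `v₁`, which is also the Jacobian of `chart`. -/
noncomputable def jac (s t : ℝ) : ℝ := √(s * (1 - s) * (1 - t))

theorem jac_pos {s t : ℝ} (hs : s ∈ Set.Ioo (0 : ℝ) 1) (ht : t ∈ Set.Ioo (0 : ℝ) 1) :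
    0 < jac s t :=
  Real.sqrt_pos.2 (mul_pos (mul_pos hs.1 (by linarith [hs.2])) (by linarith [ht.2]))

theorem jac_sq {s t : ℝ} (hs : s ∈ Set.Ioo (0 : ℝ) 1) (ht : t ∈ Set.Ioo (0 : ℝ) 1) :
    jac s t ^ 2 = s * (1 - s) * (1 - t) :=
  Real.sq_sqrt (mul_nonneg (mul_nonneg hs.1.le (by linarith [hs.2])) (by linarith [ht.2]))

/-- The coordinates `(x₁₁, x₁₂, x₂₂)` of the matrix whose first triplet is `(s, t, v)`. -/
noncomputable def chart (s t v : ℝ) : ℝ × ℝ × ℝ :=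
  (s, jac s t * v, t + (jac s t * v) ^ 2 / s)

theorem chart_snd {s t v : ℝ} (hs : s ∈ Set.Ioo (0 : ℝ) 1) (ht : t ∈ Set.Ioo (0 : ℝ) 1) :
    (chart s t v).2.2 = t + v ^ 2 * (1 - s) * (1 - t) := by
  have := hs.1.ne'
  simp only [chart, mul_pow, jac_sq hs ht]
  field_simp

theorem det_chart {s t v : ℝ} (hs : s ∈ Set.Ioo (0 : ℝ) 1) :
    (chart s t v).1 * (chart s t v).2.2 - (chart s t v).2.1 ^ 2 = s * t := by
  have := hs.1.ne'
  simp only [chart]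
  field_simp
  ring

theorem det_one_sub_chart {s t v : ℝ} (hs : s ∈ Set.Ioo (0 : ℝ) 1)
    (ht : t ∈ Set.Ioo (0 : ℝ) 1) :
    (1 - (chart s t v).1) * (1 - (chart s t v).2.2) - (chart s t v).2.1 ^ 2
      = (1 - s) * (1 - t) * (1 - v ^ 2) := by
  rw [chart_snd hs ht]
  simp only [chart, mul_pow, jac_sq hs ht]
  ring

theorem sym_chart_mem_D2_iff {s t v : ℝ} (hs : s ∈ Set.Ioo (0 : ℝ) 1)
    (ht : t ∈ Set.Ioo (0 : ℝ) 1) :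
    sym (chart s t v) ∈ D2 ↔ v ∈ Set.Ioo (-1 : ℝ) 1 := by
  rw [sym_mem_D2_iff, det_chart hs, det_one_sub_chart hs ht]
  have h1 : 0 < 1 - s := by linarith [hs.2]
  have h2 : 0 < 1 - t := by linarith [ht.2]
  have h3 : (chart s t v).1 = s := rfl
  have h5 : 0 < 1 - v ^ 2 ↔ v ∈ Set.Ioo (-1 : ℝ) 1 := by
    rw [sub_pos, sq_lt_one_iff_abs_lt_one, abs_lt, Set.mem_Ioo]
  rw [h3, mul_pos_iff_of_pos_left (mul_pos h1 h2), h5]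
  simp [hs.1, ht.1, hs.2]

theorem triplet1_sym_chart {s t v : ℝ} (hs : s ∈ Set.Ioo (0 : ℝ) 1)
    (ht : t ∈ Set.Ioo (0 : ℝ) 1) : triplet1 (sym (chart s t v)) = ![s, t, v] := by
  have hs0 := hs.1.ne'
  have hj := jac_pos hs ht
  have h3 : √((1 - s) * (s - s * (chart s t v).2.2 + (jac s t * v) ^ 2)) = jac s t := by
    conv_rhs => rw [jac]
    congr 1
    simp only [chart]
    field_simp
    ring
  ext i
  fin_cases i
  · simp [triplet1, sym, chart]
  · simp [triplet1, sym, chart]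
  · have h4 : triplet1 (sym (chart s t v)) 2 = jac s t * v /
        √((1 - s) * (s - s * (chart s t v).2.2 + (jac s t * v) ^ 2)) := rfl
    change triplet1 (sym (chart s t v)) 2 = v
    rw [h4, h3]
    field_simp

/-- Every point of `D₂` is in the image of the chart. -/
theorem chart_triplet {u : ℝ × ℝ × ℝ} (hu : sym u ∈ D2) :
    u.1 ∈ Set.Ioo (0 : ℝ) 1 ∧ u.2.2 - u.2.1 ^ 2 / u.1 ∈ Set.Ioo (0 : ℝ) 1 ∧
      chart u.1 (u.2.2 - u.2.1 ^ 2 / u.1) (u.2.1 / jac u.1 (u.2.2 - u.2.1 ^ 2 / u.1)) = u := by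
  obtain ⟨⟨h1, h2⟩, h3, h4⟩ := (sym_mem_D2_iff u).1 hu
  have hs : u.1 ∈ Set.Ioo (0 : ℝ) 1 := ⟨h1, by linarith⟩
  have ht : u.2.2 - u.2.1 ^ 2 / u.1 ∈ Set.Ioo (0 : ℝ) 1 := by
    have e : u.2.2 - u.2.1 ^ 2 / u.1 = (u.1 * u.2.2 - u.2.1 ^ 2) / u.1 := by field_simp
    have h5 : 0 < 1 - u.2.2 := by
      by_contra h
      nlinarith [sq_nonneg u.2.1]
    have h6 : 0 ≤ u.2.1 ^ 2 / u.1 := by positivity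
    exact ⟨by rw [e]; positivity, by linarith⟩
  refine ⟨hs, ht, ?_⟩
  have hj := (jac_pos hs ht).ne'
  simp only [chart]
  rw [mul_div_cancel₀ _ hj]
  simp

/-! ### Change of variables -/

theorem lintegral_comp_const_mul {c : ℝ} (hc : 0 < c) (h : ℝ → ENNReal) :
    ∫⁻ y, h y = ∫⁻ v, ENNReal.ofReal c * h (c * v) := by
  have e : MeasurableEmbedding (fun v : ℝ => c * v) :=
    (Homeomorph.mulLeft₀ c hc.ne').measurableEmbedding
  conv_lhs => rw [← Real.smul_map_volume_mul_left hc.ne']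
  rw [lintegral_smul_measure, e.lintegral_map, abs_of_pos hc, smul_eq_mul,
    lintegral_const_mul' _ _ ENNReal.ofReal_ne_top]

/-- The change of variables `x = chart s t v` on `D₂`. It is the composition of a translation
of `x₂₂` and a scaling of `x₁₂`, which Fubini's theorem allows to be performed one at a time. -/
theorem lintegral_eq_lintegral_chart (Φ : ℝ × ℝ × ℝ → ENNReal) (hΦ : Measurable Φ)
    (h0 : ∀ u, sym u ∉ D2 → Φ u = 0) :
    ∫⁻ u, Φ u = ∫⁻ s in Set.Ioo (0 : ℝ) 1, ∫⁻ t in Set.Ioo (0 : ℝ) 1,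
      ∫⁻ v in Set.Ioo (-1 : ℝ) 1, ENNReal.ofReal (jac s t) * Φ (chart s t v) := by
  rw [Measure.volume_eq_prod, lintegral_prod _ hΦ.aemeasurable,
    ← lintegral_indicator measurableSet_Ioo]
  refine lintegral_congr fun s => ?_
  by_cases hs : s ∈ Set.Ioo (0 : ℝ) 1
  swap
  · rw [Set.indicator_of_notMem hs]
    refine (lintegral_congr fun p => h0 _ fun h => hs ?_).trans lintegral_zero
    have := (sym_mem_D2_iff _).1 h
    exact ⟨this.1.1, by linarith [this.2.1]⟩
  rw [Set.indicator_of_mem hs, Measure.volume_eq_prod,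
    lintegral_prod _ (show Measurable fun p : ℝ × ℝ => Φ (s, p) from
      hΦ.comp (by fun_prop)).aemeasurable]
  have hshift : ∀ y : ℝ, ∫⁻ z, Φ (s, y, z) = ∫⁻ t, Φ (s, y, t + y ^ 2 / s) := fun y =>
    (lintegral_add_right_eq_self (fun z => Φ (s, y, z)) (y ^ 2 / s)).symm
  have hm : Measurable fun p : ℝ × ℝ => Φ (s, p.1, p.2 + p.1 ^ 2 / s) :=
    hΦ.comp (by fun_prop)
  simp_rw [hshift]
  rw [lintegral_lintegral_swap hm.aemeasurable, ← lintegral_indicator measurableSet_Ioo]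
  refine lintegral_congr fun t => ?_
  by_cases ht : t ∈ Set.Ioo (0 : ℝ) 1
  swap
  · rw [Set.indicator_of_notMem ht]
    refine (lintegral_congr fun y => h0 _ fun h => ht ?_).trans lintegral_zero
    simpa using (chart_triplet h).2.1
  rw [Set.indicator_of_mem ht, lintegral_comp_const_mul (jac_pos hs ht),
    ← lintegral_indicator measurableSet_Ioo]
  refine lintegral_congr fun v => ?_
  by_cases hv : v ∈ Set.Ioo (-1 : ℝ) 1
  · rw [Set.indicator_of_mem hv]; rfl
  · rw [Set.indicator_of_notMem hv]
    have : Φ (s, jac s t * v, t + (jac s t * v) ^ 2 / s) = 0 :=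
      h0 (chart s t v) fun h => hv ((sym_chart_mem_D2_iff hs ht).1 h)
    rw [this, mul_zero]

theorem ae_ne_offDiag : ∀ᵐ u : ℝ × ℝ × ℝ, u.2.1 ≠ 0 := by
  have h1 : ∀ᵐ y : ℝ, y ≠ 0 := by simp [ae_iff]
  have h2 : ∀ᵐ p : ℝ × ℝ, p.1 ≠ 0 := Measure.quasiMeasurePreserving_fst.ae h1
  exact Measure.quasiMeasurePreserving_snd.ae h2

/-- The law on `D₂` with density `f`, in the coordinates `(x₁₁, x₁₂, x₂₂)`; the hyperplane
`x₁₂ = 0` is negligible. -/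
theorem lawOnD2_apply (f : Mat2 → ℝ) {A : Set Mat2} (hA : MeasurableSet A) :
    lawOnD2 f A = ∫⁻ u, (offDiag ∩ sym ⁻¹' A).indicator
      (fun u => ENNReal.ofReal (f (sym u))) u := by
  rw [lawOnD2, withDensity_apply _ hA, symLebesgue, measurableEmbedding_sym.restrict_map,
    measurableEmbedding_sym.lintegral_map,
    ← lintegral_indicator (measurable_sym hA)]
  refine lintegral_congr_ae ?_
  filter_upwards [ae_ne_offDiag] with u hu
  by_cases h1 : sym u ∈ A <;> by_cases h2 : sym u ∈ D2 <;>
    simp [Set.indicator, h1, h2, mem_offDiag_iff, hu]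

theorem measurable_triplet1 (i : Fin 3) : Measurable fun x => triplet1 x i := by
  have h00 := measurable_entry 0 0
  have h01 := measurable_entry 0 1
  have h11 := measurable_entry 1 1
  fin_cases i
  · exact h00
  · exact h11.sub ((h01.pow_const 2).div h00)
  · exact h01.div (((measurable_const.sub h00).mul
      ((h00.sub (h00.mul h11)).add (h01.pow_const 2))).sqrt)

theorem measurableSet_triplet1_mem {S T V : Set ℝ} (hS : MeasurableSet S) (hT : MeasurableSet T)
    (hV : MeasurableSet V) :
    MeasurableSet {x | triplet1 x 0 ∈ S ∧ triplet1 x 1 ∈ T ∧ triplet1 x 2 ∈ V} :=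
  (measurable_triplet1 0 hS).inter ((measurable_triplet1 1 hT).inter (measurable_triplet1 2 hV))

/-- The joint law of the first triplet. -/
theorem lawOnD2_triplet1_mem {f : Mat2 → ℝ} (hf : ContinuousOn (fun u => f (sym u)) offDiag)
    {S T V : Set ℝ} (hS : MeasurableSet S) (hT : MeasurableSet T) (hV : MeasurableSet V) :
    lawOnD2 f {x | triplet1 x 0 ∈ S ∧ triplet1 x 1 ∈ T ∧ triplet1 x 2 ∈ V} =
      ∫⁻ s in Set.Ioo (0 : ℝ) 1 ∩ S, ∫⁻ t in Set.Ioo (0 : ℝ) 1 ∩ T,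
        ∫⁻ v in Set.Ioo (-1 : ℝ) 1 ∩ V,
          ENNReal.ofReal (jac s t * f (sym (chart s t v))) := by
  have hA := measurableSet_triplet1_mem hS hT hV
  rw [lawOnD2_apply f hA, lintegral_eq_lintegral_chart]
  rotate_left
  · have hU := isOpen_offDiag.measurableSet
    have h1 : Measurable (offDiag.indicator fun u => ENNReal.ofReal (f (sym u))) := by
      classical
      rw [← Set.piecewise_eq_indicator]
      exact (ENNReal.continuous_ofReal.comp_continuousOn hf).measurable_piecewise
        continuousOn_const hU
    rw [Set.inter_comm, ← Set.indicator_indicator]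
    exact h1.indicator (measurable_sym hA)
  · intro u hu
    simp [Set.indicator, mem_offDiag_iff, hu]
  rw [Set.inter_comm _ S, ← Measure.restrict_restrict hS, ← lintegral_indicator hS]
  refine setLIntegral_congr_fun measurableSet_Ioo fun s hs => ?_
  by_cases hsS : s ∈ S
  swap
  · rw [Set.indicator_of_notMem hsS]
    refine (setLIntegral_congr_fun measurableSet_Ioo fun t ht => ?_).trans lintegral_zero
    refine (setLIntegral_congr_fun measurableSet_Ioo fun v hv => ?_).trans lintegral_zero
    simp [triplet1_sym_chart hs ht, hsS]
  rw [Set.indicator_of_mem hsS]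
  rw [Set.inter_comm _ T, ← Measure.restrict_restrict hT, ← lintegral_indicator hT]
  refine setLIntegral_congr_fun measurableSet_Ioo fun t ht => ?_
  by_cases htT : t ∈ T
  swap
  · rw [Set.indicator_of_notMem htT]
    refine (setLIntegral_congr_fun measurableSet_Ioo fun v hv => ?_).trans lintegral_zero
    simp [triplet1_sym_chart hs ht, htT]
  rw [Set.indicator_of_mem htT]
  rw [Set.inter_comm _ V, ← Measure.restrict_restrict hV, ← lintegral_indicator hV]
  refine setLIntegral_congr_fun_ae measurableSet_Ioo ?_
  have hne : ∀ᵐ v : ℝ, v ≠ 0 := by simp [ae_iff]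
  filter_upwards [hne] with v hv0 hv
  have hoff : chart s t v ∈ offDiag :=
    (mem_offDiag_iff _).2 ⟨(sym_chart_mem_D2_iff hs ht).2 hv, mul_ne_zero (jac_pos hs ht).ne' hv0⟩
  by_cases hvV : v ∈ V <;>
    simp [Set.indicator, triplet1_sym_chart hs ht, hsS, htT, hvV, hoff,
      ENNReal.ofReal_mul (jac_pos hs ht).le]

/-! ### The functional equation -/

/-- The functional equation obtained by writing the logarithm of one density through both triplets.
Here `(s, t)` and `(s', t')` are the first two components of the triplets of one matrix and the
arguments of `A₃` and `B₃` are the squares of the third ones; `s * t = s' * t'` is the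
determinant. -/
def TripletEquation (A₁ A₂ A₃ B₁ B₂ B₃ : ℝ → ℝ) : Prop :=
  ∀ s t s' t' : ℝ, s ∈ Set.Ioo (0 : ℝ) 1 → t ∈ Set.Ioo (0 : ℝ) 1 → s' ∈ Set.Ioo (0 : ℝ) 1 →
    t' ∈ Set.Ioo (0 : ℝ) 1 → s * t = s' * t' → t < s' → s + s' < 1 + s * t →
    A₁ s + A₂ t + A₃ ((s' - t) / ((1 - s) * (1 - t))) =
      B₁ s' + B₂ t' + B₃ ((s - t') / ((1 - s') * (1 - t')))

/-- The square of the third component of the triplet, written through `s = x₁₁`, `t` and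
`s' = x₂₂`. -/
theorem third_sq_mem_Ioo {s t s' : ℝ} (hs : s < 1) (ht : t < 1) (h1 : t < s')
    (h2 : s + s' < 1 + s * t) : (s' - t) / ((1 - s) * (1 - t)) ∈ Set.Ioo (0 : ℝ) 1 := by
  have h : 0 < (1 - s) * (1 - t) := mul_pos (by linarith) (by linarith)
  exact ⟨div_pos (by linarith) h, (div_lt_one h).2 (by nlinarith)⟩

theorem hasDerivAt_third_sq {s t s' ds dt ds' : ℝ} (hs : s < 1) (ht : t < 1)
    (h0 : (ds' - dt) * ((1 - s) * (1 - t)) + (s' - t) * (ds * (1 - t) + dt * (1 - s)) = 0) :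
    HasDerivAt (fun e : ℝ => ((s' + e * ds') - (t + e * dt)) /
      ((1 - (s + e * ds)) * (1 - (t + e * dt)))) 0 0 := by
  have lin : ∀ a b : ℝ, HasDerivAt (fun e : ℝ => a + e * b) b 0 := fun a b => by
    simpa using ((hasDerivAt_id (0 : ℝ)).mul_const b).const_add a
  have h1 := (lin s' ds').sub (lin t dt)
  have h2 := ((lin s ds).const_sub 1).mul ((lin t dt).const_sub 1)
  have hne : (1 - (s + 0 * ds)) * (1 - (t + 0 * dt)) ≠ 0 := by
    simp only [zero_mul, add_zero]
    exact (mul_pos (by linarith) (by linarith)).ne'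
  refine (h1.div h2 hne).congr_deriv ?_
  rw [div_eq_zero_iff]
  left
  simp only [zero_mul, add_zero, Pi.sub_apply, Pi.mul_apply]
  linear_combination h0

/-- Differentiating the functional equation in the direction that fixes both third components
eliminates `A₃` and `B₃`. -/
theorem TripletEquation.deriv_eq {A₁ A₂ A₃ B₁ B₂ B₃ : ℝ → ℝ}
    (h : TripletEquation A₁ A₂ A₃ B₁ B₂ B₃)
    (hA₁ : ∀ s ∈ Set.Ioo (0 : ℝ) 1, DifferentiableAt ℝ A₁ s)
    (hA₂ : ∀ s ∈ Set.Ioo (0 : ℝ) 1, DifferentiableAt ℝ A₂ s)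
    (hA₃ : ∀ s ∈ Set.Ioo (0 : ℝ) 1, DifferentiableAt ℝ A₃ s)
    (hB₁ : ∀ s ∈ Set.Ioo (0 : ℝ) 1, DifferentiableAt ℝ B₁ s)
    (hB₂ : ∀ s ∈ Set.Ioo (0 : ℝ) 1, DifferentiableAt ℝ B₂ s)
    (hB₃ : ∀ s ∈ Set.Ioo (0 : ℝ) 1, DifferentiableAt ℝ B₃ s)
    {s t s' t' : ℝ} (hs : s ∈ Set.Ioo (0 : ℝ) 1) (ht : t ∈ Set.Ioo (0 : ℝ) 1)
    (hs' : s' ∈ Set.Ioo (0 : ℝ) 1) (ht' : t' ∈ Set.Ioo (0 : ℝ) 1) (hst : s * t = s' * t')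
    (h1 : t < s') (h2 : s + s' < 1 + s * t) :
    t' * (1 - s) * (1 - s') * (s * deriv A₁ s - s' * deriv B₁ s') +
      s * (1 - t) * (1 - t') * (t * deriv A₂ t - t' * deriv B₂ t') = 0 := by
  have h1' : t' < s := by
    by_contra hcon
    nlinarith [mul_pos ht.1 hs.1, hs'.1, ht'.1, hs.1, ht.1]
  -- the direction of the curve is `(s * p, t * q)`, and `(s' * p, t' * q)` for the other triplet
  set p := t' * (1 - s) * (1 - s') with hp
  set q := s * (1 - t) * (1 - t') with hq
  have lin : ∀ a b : ℝ, HasDerivAt (fun e : ℝ => a + e * b) b 0 := fun a b => by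
    simpa using ((hasDerivAt_id (0 : ℝ)).mul_const b).const_add a
  have comp1 : ∀ (F : ℝ → ℝ) (a b : ℝ), DifferentiableAt ℝ F a →
      HasDerivAt (fun e : ℝ => F (a + e * b)) (deriv F a * b) 0 := fun F a b hF => by
    have : HasDerivAt F (deriv F a) (a + 0 * b) := by
      rw [zero_mul, add_zero]
      exact hF.hasDerivAt
    exact this.comp (0 : ℝ) (lin a b)
  have dw : HasDerivAt (fun e : ℝ => ((s' + e * (s' * p)) - (t + e * (t * q))) /
      ((1 - (s + e * (s * p))) * (1 - (t + e * (t * q))))) 0 0 := by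
    apply hasDerivAt_third_sq hs.2 ht.2
    rw [hp, hq]
    linear_combination (-(1 - s) * (1 - t) * (1 - s')) * hst
  have dw' : HasDerivAt (fun e : ℝ => ((s + e * (s * p)) - (t' + e * (t' * q))) /
      ((1 - (s' + e * (s' * p))) * (1 - (t' + e * (t' * q))))) 0 0 := by
    apply hasDerivAt_third_sq hs'.2 ht'.2
    rw [hp, hq]
    linear_combination ((1 - s) * (1 - s') * (1 - t') * t') * hst
  have comp3 : ∀ (F w : ℝ → ℝ), DifferentiableAt ℝ F (w 0) → HasDerivAt w 0 0 →
      HasDerivAt (fun e : ℝ => F (w e)) 0 0 := fun F w hF hw =>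
    (hF.hasDerivAt.comp (0 : ℝ) hw).congr_deriv (mul_zero _)
  have hw := comp3 A₃ _ (by simpa using hA₃ _ (third_sq_mem_Ioo hs.2 ht.2 h1 h2)) dw
  have hw' := comp3 B₃ _ (by
    simpa using hB₃ _ (third_sq_mem_Ioo hs'.2 ht'.2 h1' (by rw [← hst]; linarith))) dw'
  have hL := ((comp1 A₁ s (s * p) (hA₁ s hs)).add (comp1 A₂ t (t * q) (hA₂ t ht))).add hw
  have hR := ((comp1 B₁ s' (s' * p) (hB₁ s' hs')).add (comp1 B₂ t' (t' * q) (hB₂ t' ht'))).add hw'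
  have ev : ∀ (a b : ℝ), a ∈ Set.Ioo (0 : ℝ) 1 →
      ∀ᶠ e in nhds (0 : ℝ), a + e * b ∈ Set.Ioo (0 : ℝ) 1 := fun a b ha =>
    (lin a b).continuousAt.eventually_mem (by simpa using isOpen_Ioo.mem_nhds ha)
  have evlt : ∀ F : ℝ → ℝ, ContinuousAt F 0 → 0 < F 0 → ∀ᶠ e in nhds (0 : ℝ), 0 < F e :=
    fun F hF h0 => hF.eventually_const_lt h0
  have heq : ∀ᶠ e in nhds (0 : ℝ), A₁ (s + e * (s * p)) + A₂ (t + e * (t * q)) +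
        A₃ (((s' + e * (s' * p)) - (t + e * (t * q))) /
          ((1 - (s + e * (s * p))) * (1 - (t + e * (t * q))))) =
      B₁ (s' + e * (s' * p)) + B₂ (t' + e * (t' * q)) +
        B₃ (((s + e * (s * p)) - (t' + e * (t' * q))) /
          ((1 - (s' + e * (s' * p))) * (1 - (t' + e * (t' * q))))) := by
    filter_upwards [ev s (s * p) hs, ev t (t * q) ht, ev s' (s' * p) hs', ev t' (t' * q) ht',
      evlt (fun e => (s' + e * (s' * p)) - (t + e * (t * q))) (by fun_prop) (by simpa using h1),
      evlt (fun e => 1 + (s + e * (s * p)) * (t + e * (t * q)) - (s + e * (s * p))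
        - (s' + e * (s' * p))) (by fun_prop) (by simp only [zero_mul, add_zero]; linarith)]
      with e e1 e2 e3 e4 e5 e6
    refine h _ _ _ _ e1 e2 e3 e4 ?_ (by linarith) (by linarith)
    linear_combination (1 + e * p) * (1 + e * q) * hst
  have key := hL.unique (hR.congr_of_eventuallyEq heq)
  linear_combination key

theorem add_eq_zero_of_quadratic_eq_zero {A B C ε : ℝ} (hε : 0 < ε)
    (h : ∀ l ∈ Set.Ioo 0 ε, A + B * l + C * l ^ 2 = 0) : A + B + C = 0 := by
  have h1 := h (ε / 4) ⟨by linarith, by linarith⟩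
  have h2 := h (ε / 2) ⟨by linarith, by linarith⟩
  have h3 := h (3 * ε / 4) ⟨by linarith, by linarith⟩
  have hC : C = 0 := by
    have : C * ε ^ 2 = 0 := by linear_combination 8 * h1 - 16 * h2 + 8 * h3
    simpa [hε.ne'] using this
  subst hC
  have hB : B = 0 := by
    have : B * ε = 0 := by linear_combination 4 * h2 - 4 * h1
    simpa [hε.ne'] using this
  subst hB
  linarith

/-- A function that is locally constant on an open interval is constant there. -/
theorem eq_of_locally_const_on_Ioo {P : ℝ → ℝ} {a b : ℝ}
    (h : ∀ x ∈ Set.Ioo a b, ∀ᶠ y in nhds x, P y = P x) {x y : ℝ} (hx : x ∈ Set.Ioo a b)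
    (hy : y ∈ Set.Ioo a b) : P x = P y := by
  have hd : ∀ x ∈ Set.Ioo a b, HasDerivAt P 0 x := fun x hx =>
    (hasDerivAt_const x (P x)).congr_of_eventuallyEq (h x hx)
  exact isOpen_Ioo.is_const_of_deriv_eq_zero isPreconnected_Ioo
    (fun x hx => (hd x hx).differentiableAt.differentiableWithinAt)
    (fun x hx => (hd x hx).deriv) hx hy

/-- The equation satisfied by the logarithmic derivatives `a₁ = s A₁'(s)`, etc. -/
def LogDerivEquation (a₁ a₂ b₁ b₂ : ℝ → ℝ) : Prop :=
  ∀ s t s' t' : ℝ, s ∈ Set.Ioo (0 : ℝ) 1 → t ∈ Set.Ioo (0 : ℝ) 1 → s' ∈ Set.Ioo (0 : ℝ) 1 →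
    t' ∈ Set.Ioo (0 : ℝ) 1 → s * t = s' * t' → t < s' → s + s' < 1 + s * t →
    t' * (1 - s) * (1 - s') * (a₁ s - b₁ s') + s * (1 - t) * (1 - t') * (a₂ t - b₂ t') = 0

/-- For a fixed ratio `κ = s' / s = t / t'` the two summands of the equation separate, up to a
constant depending on `κ`. -/
theorem LogDerivEquation.exists_const {a₁ a₂ b₁ b₂ : ℝ → ℝ}
    (h : LogDerivEquation a₁ a₂ b₁ b₂) {κ : ℝ} (hκ : 0 < κ) :
    ∃ C : ℝ, ∀ s ∈ Set.Ioo (0 : ℝ) 1, κ * s < 1 →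
      (1 - s) * (1 - κ * s) * (a₁ s - b₁ (κ * s)) = -C * s ∧
      (1 - s) * (1 - κ * s) * (a₂ (κ * s) - b₂ s) = C * s := by
  set P : ℝ → ℝ := fun s => (1 - s) * (1 - κ * s) * (a₁ s - b₁ (κ * s)) / s with hP
  set Q : ℝ → ℝ := fun s => (1 - s) * (1 - κ * s) * (a₂ (κ * s) - b₂ s) / s with hQ
  have hPQ : ∀ s τ : ℝ, 0 < τ → τ < s → s < 1 → κ * s < 1 → s + κ * s < 1 + s * (κ * τ) →
      P s = -Q τ := by
    intro s τ h1 h2 h3 h4 h5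
    have hs : 0 < s := h1.trans h2
    have hτ : κ * τ < κ * s := mul_lt_mul_of_pos_left h2 hκ
    have := h s (κ * τ) (κ * s) τ ⟨hs, h3⟩ ⟨by positivity, by linarith⟩ ⟨by positivity, h4⟩
      ⟨h1, by linarith⟩ (by ring) hτ h5
    rw [eq_neg_iff_add_eq_zero]
    simp only [hP, hQ]
    generalize a₁ s - b₁ (κ * s) = u at this ⊢
    generalize a₂ (κ * τ) - b₂ τ = w at this ⊢
    have hs0 := hs.ne'
    have hτ0 := h1.ne'
    field_simp
    linear_combination this
  set M : ℝ := min 1 (1 / κ) with hM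
  have hM0 : 0 < M := by positivity
  have hlt : ∀ s, s ∈ Set.Ioo 0 M ↔ s ∈ Set.Ioo (0 : ℝ) 1 ∧ κ * s < 1 := by
    intro s
    rw [hM, Set.mem_Ioo, lt_min_iff, lt_div_iff₀ hκ, mul_comm s κ, Set.mem_Ioo, and_assoc]
  have hloc : ∀ s ∈ Set.Ioo 0 M, ∀ᶠ r in nhds s, P r = P s := by
    intro s hs
    obtain ⟨hs1, hs2⟩ := (hlt s).1 hs
    -- a value `τ` admissible for `s` is admissible for the nearby points too
    have hprod : 0 < (1 - s) * (1 - κ * s) := mul_pos (by linarith [hs1.2]) (by linarith)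
    obtain ⟨τ, hτ1, hτ2⟩ : ∃ τ, max 0 ((s + κ * s - 1) / (κ * s)) < τ ∧ τ < s := by
      refine exists_between (max_lt hs1.1 ?_)
      rw [div_lt_iff₀ (mul_pos hκ hs1.1)]
      nlinarith
    rw [max_lt_iff, div_lt_iff₀ (mul_pos hκ hs1.1)] at hτ1
    have hs3 : s + κ * s < 1 + s * (κ * τ) := by nlinarith [hτ1.2]
    have hev : ∀ F : ℝ → ℝ, Continuous F → 0 < F s → ∀ᶠ r in nhds s, 0 < F r :=
      fun F hF h0 => hF.continuousAt.eventually_const_lt h0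
    filter_upwards [hev (fun r => r - τ) (by fun_prop) (by simpa using hτ2),
      hev (fun r => 1 - r) (by fun_prop) (by simpa using hs1.2),
      hev (fun r => 1 - κ * r) (by fun_prop) (by simpa using hs2),
      hev (fun r => 1 + r * (κ * τ) - (r + κ * r)) (by fun_prop) (by simpa using hs3)]
      with r h1 h2 h3 h4
    rw [hPQ r τ hτ1.1 (by linarith) (by linarith) (by linarith) (by linarith),
      hPQ s τ hτ1.1 hτ2 hs1.2 hs2 hs3]
  have hmid : M / 2 ∈ Set.Ioo 0 M := ⟨by linarith, by linarith⟩
  refine ⟨-P (M / 2), fun s hs hs' => ?_⟩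
  have hsM := (hlt s).2 ⟨hs, hs'⟩
  have hs0 := hs.1.ne'
  constructor
  · have := eq_of_locally_const_on_Ioo hloc hsM hmid
    rw [neg_neg, ← this, hP]
    field_simp
  -- here `s` plays the role of `τ`, and `r` is slightly larger
  · have hprod : 0 < (1 - s) * (1 - κ * s) := mul_pos (by linarith [hs.2]) (by linarith)
    have hden : 0 < 1 + κ * (1 - s) := by
      have := mul_pos hκ (show 0 < 1 - s by linarith [hs.2])
      linarith
    obtain ⟨r, hr1, hr2⟩ : ∃ r, s < r ∧ r < 1 / (1 + κ * (1 - s)) := by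
      refine exists_between ?_
      rw [lt_div_iff₀ hden]
      nlinarith
    rw [lt_div_iff₀ hden] at hr2
    have hr0 : 0 < r := hs.1.trans hr1
    have hr3 : r < 1 := by nlinarith [mul_pos (mul_pos hr0 hκ) (show 0 < 1 - s by linarith [hs.2])]
    have hr4 : κ * r < 1 := by
      by_contra hcon
      nlinarith [mul_pos hκ hr0]
    have h1 := hPQ r s hs.1 hr1 hr3 hr4 (by nlinarith)
    have h2 := eq_of_locally_const_on_Ioo hloc ((hlt r).2 ⟨⟨hr0, hr3⟩, hr4⟩) hmid
    rw [← h2, h1, neg_neg, hQ]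
    field_simp

/-- The solutions of the equation of the logarithmic derivatives. The constants attached to the
ratios `κ` are proportional to `κ - 1`: scaling four points by `l` yields a rational identity in
`l`, and its residue at `l = 1`, read off after clearing denominators, gives the proportionality.
No regularity of the functions is involved. -/
theorem LogDerivEquation.exists_solution {a₁ a₂ b₁ b₂ : ℝ → ℝ}
    (h : LogDerivEquation a₁ a₂ b₁ b₂) :
    ∃ g c₁ c₂ : ℝ, ∀ s ∈ Set.Ioo (0 : ℝ) 1, a₁ s = g / (1 - s) + c₁ ∧ b₁ s = g / (1 - s) + c₁ ∧
      a₂ s = g / (1 - s) + c₂ ∧ b₂ s = g / (1 - s) + c₂ := by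
  have h1 : ∀ κ : ℝ, ∃ C : ℝ, 0 < κ → ∀ s ∈ Set.Ioo (0 : ℝ) 1, κ * s < 1 →
      (1 - s) * (1 - κ * s) * (a₁ s - b₁ (κ * s)) = -C * s ∧
      (1 - s) * (1 - κ * s) * (a₂ (κ * s) - b₂ s) = C * s := by
    intro κ
    by_cases hκ : 0 < κ
    · obtain ⟨C, hC⟩ := h.exists_const hκ
      exact ⟨C, fun _ => hC⟩
    · exact ⟨0, fun h => absurd h hκ⟩
  choose C hC using h1
  have hprop : ∀ κ μ : ℝ, 0 < κ → 0 < μ → C κ * (μ - 1) = C μ * (κ - 1) := by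
    intro κ μ hκ hμ
    -- the four points are `l / κ`, `l / μ` for `a₁` and `l`, `2 * l` for `b₁`
    have hquad : ∀ l ∈ Set.Ioo 0 (min (1 / 2) (min κ μ)),
        (C κ * μ - C μ * κ - C (2 * κ) * μ + C (2 * μ) * κ)
        + (-C κ * (1 + 2 * μ) + C μ * (1 + 2 * κ) + C (2 * κ) * (1 + μ)
          - C (2 * μ) * (1 + κ)) * l
        + (2 * C κ - 2 * C μ - C (2 * κ) + C (2 * μ)) * l ^ 2
          = 0 := by
      intro l hl
      obtain ⟨hl0, hl1⟩ := hl
      rw [lt_min_iff, lt_min_iff] at hl1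
      obtain ⟨hl1, hl2, hl3⟩ := hl1
      have hx : l / κ ∈ Set.Ioo (0 : ℝ) 1 := ⟨by positivity, (div_lt_one hκ).2 hl2⟩
      have hy : l / μ ∈ Set.Ioo (0 : ℝ) 1 := ⟨by positivity, (div_lt_one hμ).2 hl3⟩
      have e1 : κ * (l / κ) = l := by field_simp
      have e2 : μ * (l / μ) = l := by field_simp
      have e3 : 2 * κ * (l / κ) = 2 * l := by field_simp
      have e4 : 2 * μ * (l / μ) = 2 * l := by field_simp
      have f1 := (hC κ hκ _ hx (by rw [e1]; linarith)).1
      have f2 := (hC μ hμ _ hy (by rw [e2]; linarith)).1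
      have f3 := (hC (2 * κ) (by positivity) _ hx (by rw [e3]; linarith)).1
      have f4 := (hC (2 * μ) (by positivity) _ hy (by rw [e4]; linarith)).1
      rw [e1] at f1
      rw [e2] at f2
      rw [e3] at f3
      rw [e4] at f4
      generalize a₁ (l / κ) = u at f1 f3
      generalize a₁ (l / μ) = u' at f2 f4
      generalize b₁ l = w at f1 f2
      generalize b₁ (2 * l) = w' at f3 f4
      have g1 : (κ - l) * (1 - l) * (u - w) = -C κ * l := by
        linear_combination κ * f1 + ((1 - l) * (u - w) - C κ) * e1
      have g2 : (μ - l) * (1 - l) * (u' - w) = -C μ * l := by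
        linear_combination μ * f2 + ((1 - l) * (u' - w) - C μ) * e2
      have g3 : (κ - l) * (1 - 2 * l) * (u - w') = -C (2 * κ) * l := by
        linear_combination κ * f3 + ((1 - 2 * l) * (u - w') - C (2 * κ)) * e1
      have g4 : (μ - l) * (1 - 2 * l) * (u' - w') = -C (2 * μ) * l := by
        linear_combination μ * f4 + ((1 - 2 * l) * (u' - w') - C (2 * μ)) * e2
      refine (mul_eq_zero.1 ?_).resolve_left hl0.ne'
      linear_combination (μ - l) * (1 - 2 * l) * g1 - (κ - l) * (1 - 2 * l) * g2
        - (μ - l) * (1 - l) * g3 + (κ - l) * (1 - l) * g4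
    have := add_eq_zero_of_quadratic_eq_zero (by positivity) hquad
    linear_combination -this
  have hC2 : ∀ κ, 0 < κ → C κ = C 2 * (κ - 1) := fun κ hκ => by
    have := hprop κ 2 hκ two_pos
    linarith
  have hsep : ∀ s ∈ Set.Ioo (0 : ℝ) 1, ∀ r ∈ Set.Ioo (0 : ℝ) 1,
      a₁ s - C 2 / (1 - s) = b₁ r - C 2 / (1 - r) ∧
      a₂ r - C 2 / (1 - r) = b₂ s - C 2 / (1 - s) := by
    intro s hs r hr
    have hκ : 0 < r / s := div_pos hr.1 hs.1
    have e : r / s * s = r := div_mul_cancel₀ _ hs.1.ne'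
    have hs1 : 1 - s ≠ 0 := by linarith [hs.2]
    have hr1 : 1 - r ≠ 0 := by linarith [hr.2]
    have e' : C (r / s) * s = C 2 * (r - s) := by
      rw [hC2 _ hκ]
      linear_combination C 2 * e
    obtain ⟨f1, f2⟩ := hC _ hκ s hs (by rw [e]; exact hr.2)
    rw [e] at f1 f2
    constructor
    · field_simp
      linear_combination f1 - e'
    · field_simp
      linear_combination f2 + e'
  have hhalf : (1 / 2 : ℝ) ∈ Set.Ioo (0 : ℝ) 1 := ⟨by norm_num, by norm_num⟩
  refine ⟨C 2, b₁ (1 / 2) - C 2 / (1 - 1 / 2), b₂ (1 / 2) - C 2 / (1 - 1 / 2), fun s hs => ?_⟩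
  have g1 := hsep s hs _ hhalf
  have g2 := hsep _ hhalf s hs
  have g3 := hsep _ hhalf _ hhalf
  exact ⟨by linarith, by linarith, by linarith, by linarith⟩

/-- Integration of `s A'(s) = g / (1 - s) + c`. -/
theorem eq_log_of_deriv {A : ℝ → ℝ} (hA : ∀ s ∈ Set.Ioo (0 : ℝ) 1, DifferentiableAt ℝ A s)
    {g c : ℝ} (h : ∀ s ∈ Set.Ioo (0 : ℝ) 1, s * deriv A s = g / (1 - s) + c) :
    ∃ k : ℝ, ∀ s ∈ Set.Ioo (0 : ℝ) 1,
      A s = (c + g) * Real.log s - g * Real.log (1 - s) + k := by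
  set R : ℝ → ℝ := fun s => A s - ((c + g) * Real.log s - g * Real.log (1 - s)) with hR
  have hd : ∀ s ∈ Set.Ioo (0 : ℝ) 1, HasDerivAt R 0 s := by
    intro s hs
    have hs0 := hs.1.ne'
    have hs1 : 1 - s ≠ 0 := by linarith [hs.2]
    have h1 := (hA s hs).hasDerivAt
    have h2 := (Real.hasDerivAt_log hs0).const_mul (c + g)
    have h3 := (((hasDerivAt_id s).const_sub 1).log hs1).const_mul g
    refine (h1.sub (h2.sub h3)).congr_deriv ?_
    have h4 : deriv A s = (g / (1 - s) + c) / s := by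
      rw [← h s hs]; field_simp
    rw [h4]
    simp only [id]
    field_simp
    ring
  have hhalf : (1 / 2 : ℝ) ∈ Set.Ioo (0 : ℝ) 1 := ⟨by norm_num, by norm_num⟩
  refine ⟨R (1 / 2), fun s hs => ?_⟩
  have : R s = R (1 / 2) := isOpen_Ioo.is_const_of_deriv_eq_zero isPreconnected_Ioo
    (fun x hx => (hd x hx).differentiableAt.differentiableWithinAt)
    (fun x hx => (hd x hx).deriv) hs hhalf
  rw [← this, hR]
  ring

/-- Any two numbers of `(0, 1)` are the squares of the third components of the two triplets of
some matrix. -/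
theorem exists_third_sq_eq {w w' : ℝ} (hw : w ∈ Set.Ioo (0 : ℝ) 1)
    (hw' : w' ∈ Set.Ioo (0 : ℝ) 1) :
    ∃ s t s' t' : ℝ, s ∈ Set.Ioo (0 : ℝ) 1 ∧ t ∈ Set.Ioo (0 : ℝ) 1 ∧
      s' ∈ Set.Ioo (0 : ℝ) 1 ∧ t' ∈ Set.Ioo (0 : ℝ) 1 ∧ s * t = s' * t' ∧ t < s' ∧
      s + s' < 1 + s * t ∧ (s' - t) / ((1 - s) * (1 - t)) = w ∧
      (s - t') / ((1 - s') * (1 - t')) = w' := by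
  obtain ⟨hw0, hw1⟩ := hw
  obtain ⟨hw0', hw1'⟩ := hw'
  -- `w' = ρ * τ` with `ρ = s / (1 - w * (1 - s))` and `τ = w / (t + w * (1 - t))`
  obtain ⟨τ, hτ, hτ1⟩ : ∃ τ, max w w' < τ ∧ τ < 1 := exists_between (max_lt hw1 hw1')
  obtain ⟨hτw, hτw'⟩ := max_lt_iff.1 hτ
  have hτ0 : 0 < τ := hw0.trans hτw
  obtain ⟨ρ, hρ⟩ : ∃ ρ, ρ = w' / τ := ⟨_, rfl⟩
  have hρ0 : 0 < ρ := by rw [hρ]; positivity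
  have hρ1 : ρ < 1 := by rw [hρ]; exact (div_lt_one hτ0).2 hτw'
  have hρτ : ρ * τ = w' := by rw [hρ]; field_simp
  have hu : 0 < 1 - w := by linarith
  have hρw : 0 < 1 - ρ * w := by nlinarith
  obtain ⟨s, hs⟩ : ∃ s, s = ρ * (1 - w) / (1 - ρ * w) := ⟨_, rfl⟩
  obtain ⟨t, ht⟩ : ∃ t, t = w * (1 - τ) / (τ * (1 - w)) := ⟨_, rfl⟩
  have hs0 : 0 < s := by rw [hs]; positivity
  have hs1 : s < 1 := by rw [hs, div_lt_one hρw]; nlinarith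
  have ht0 : 0 < t := by
    rw [ht]; exact div_pos (mul_pos hw0 (by linarith)) (by positivity)
  have ht1 : t < 1 := by rw [ht, div_lt_one (by positivity)]; nlinarith
  obtain ⟨s', hs'⟩ : ∃ s', s' = t + w * (1 - s) * (1 - t) := ⟨_, rfl⟩
  have hm : 0 < (1 - s) * (1 - t) := mul_pos (by linarith) (by linarith)
  have hwm : 0 < w * ((1 - s) * (1 - t)) := mul_pos hw0 hm
  have hwm' : w * ((1 - s) * (1 - t)) < (1 - s) * (1 - t) := by nlinarith
  have hs'0 : 0 < s' := by rw [hs']; nlinarith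
  have hs'1 : s' < 1 := by rw [hs']; nlinarith
  have hts : t < s' := by rw [hs']; nlinarith
  refine ⟨s, t, s', s * t / s', ⟨hs0, hs1⟩, ⟨ht0, ht1⟩, ⟨hs'0, hs'1⟩,
    ⟨by positivity, (div_lt_one hs'0).2 (by nlinarith)⟩, by field_simp, hts, ?_, ?_, ?_⟩
  · rw [hs']; nlinarith
  · rw [hs', div_eq_iff hm.ne']; ring
  · have e1 : s * (1 - ρ * w) = ρ * (1 - w) := by rw [hs]; field_simp
    have e2 : t * (τ * (1 - w)) = w * (1 - τ) := by rw [ht]; field_simp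
    have hst : 0 < s' - s * t := by nlinarith
    have e3 : (s - s * t / s') / ((1 - s') * (1 - s * t / s'))
        = s * (s' - t) / ((1 - s') * (s' - s * t)) := by
      have h1 : 1 - s' ≠ 0 := by linarith
      have h2 : s' - s * t ≠ 0 := hst.ne'
      have h3 : 1 - s * t / s' ≠ 0 := by
        rw [one_sub_div hs'0.ne']; positivity
      field_simp
    have hden : 0 < (1 - s') * (s' - s * t) := mul_pos (by linarith) hst
    rw [e3, div_eq_iff hden.ne']
    -- both sides are multiples of `(1 - s) * (1 - t)`
    have f1 : s' - t = w * ((1 - s) * (1 - t)) := by rw [hs']; ring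
    have f2 : 1 - s' = (1 - t) * (1 - w * (1 - s)) := by rw [hs']; ring
    have f3 : s' - s * t = (1 - s) * (t + w * (1 - t)) := by rw [hs']; ring
    have f4 : s = ρ * (1 - w * (1 - s)) := by linear_combination e1
    have f5 : w = τ * (t + w * (1 - t)) := by linear_combination -e2
    rw [f1, f2, f3, ← hρτ]
    calc s * (w * ((1 - s) * (1 - t))) = (ρ * (1 - w * (1 - s))) * ((τ * (t + w * (1 - t))) *
          ((1 - s) * (1 - t))) := by rw [← f4, ← f5]
      _ = _ := by ring

/-- The solutions of the functional equation. The equation is assumed for a family of pairs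
`A₃ i`, `B₃ i`, with the other four functions in common. -/
theorem TripletEquation.exists_solution {ι : Type*} [Nonempty ι] {A₁ A₂ B₁ B₂ : ℝ → ℝ}
    {A₃ B₃ : ι → ℝ → ℝ} (h : ∀ i, TripletEquation A₁ A₂ (A₃ i) B₁ B₂ (B₃ i))
    (hA₁ : ∀ s ∈ Set.Ioo (0 : ℝ) 1, DifferentiableAt ℝ A₁ s)
    (hA₂ : ∀ s ∈ Set.Ioo (0 : ℝ) 1, DifferentiableAt ℝ A₂ s)
    (hA₃ : ∀ i, ∀ s ∈ Set.Ioo (0 : ℝ) 1, DifferentiableAt ℝ (A₃ i) s)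
    (hB₁ : ∀ s ∈ Set.Ioo (0 : ℝ) 1, DifferentiableAt ℝ B₁ s)
    (hB₂ : ∀ s ∈ Set.Ioo (0 : ℝ) 1, DifferentiableAt ℝ B₂ s)
    (hB₃ : ∀ i, ∀ s ∈ Set.Ioo (0 : ℝ) 1, DifferentiableAt ℝ (B₃ i) s) :
    ∃ (α β γ k₁ k₂ : ℝ) (k : ι → ℝ), ∀ s ∈ Set.Ioo (0 : ℝ) 1,
      A₁ s = (α + γ) * Real.log s + (β + γ) * Real.log (1 - s) + k₁ ∧
      A₂ s = α * Real.log s + (β + γ) * Real.log (1 - s) + k₂ ∧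
      ∀ i, A₃ i s = γ * Real.log s + β * Real.log (1 - s) + k i := by
  obtain ⟨i₀⟩ := ‹Nonempty ι›
  have hld : LogDerivEquation (fun s => s * deriv A₁ s) (fun s => s * deriv A₂ s)
      (fun s => s * deriv B₁ s) (fun s => s * deriv B₂ s) :=
    fun s t s' t' hs ht hs' ht' hst h1 h2 =>
      (h i₀).deriv_eq hA₁ hA₂ (hA₃ i₀) hB₁ hB₂ (hB₃ i₀) hs ht hs' ht' hst h1 h2
  obtain ⟨g, c₁, c₂, hsol⟩ := hld.exists_solution
  obtain ⟨kA₁, hkA₁⟩ := eq_log_of_deriv hA₁ fun s hs => (hsol s hs).1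
  obtain ⟨kA₂, hkA₂⟩ := eq_log_of_deriv hA₂ fun s hs => (hsol s hs).2.2.1
  obtain ⟨kB₁, hkB₁⟩ := eq_log_of_deriv hB₁ fun s hs => (hsol s hs).2.1
  obtain ⟨kB₂, hkB₂⟩ := eq_log_of_deriv hB₂ fun s hs => (hsol s hs).2.2.2
  set T : ℝ → ℝ := fun w => (c₁ - c₂) * Real.log w + (-g - (c₁ - c₂)) * Real.log (1 - w) with hT
  have hdiff : ∀ i, ∀ w ∈ Set.Ioo (0 : ℝ) 1, ∀ w' ∈ Set.Ioo (0 : ℝ) 1,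
      A₃ i w - T w = B₃ i w' - T w' + (kB₁ + kB₂ - kA₁ - kA₂) := by
    intro i w hw w' hw'
    obtain ⟨s, t, s', t', hs, ht, hs', ht', hst, h1, h2, e1, e2⟩ := exists_third_sq_eq hw hw'
    have key := h i s t s' t' hs ht hs' ht' hst h1 h2
    rw [e1, e2, hkA₁ s hs, hkA₂ t ht, hkB₁ s' hs', hkB₂ t' ht'] at key
    have p1 : 0 < 1 - s := by linarith [hs.2]
    have p2 : 0 < 1 - t := by linarith [ht.2]
    have p1' : 0 < 1 - s' := by linarith [hs'.2]
    have p2' : 0 < 1 - t' := by linarith [ht'.2]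
    have p3 : 0 < 1 - w := by linarith [hw.2]
    have p3' : 0 < 1 - w' := by linarith [hw'.2]
    have q1 : s' - t = w * ((1 - s) * (1 - t)) := by rw [← e1]; field_simp
    have q2 : s - t' = w' * ((1 - s') * (1 - t')) := by rw [← e2]; field_simp
    -- the logarithms of the determinants of `x` and `1 - x` and of `x₁₂ ^ 2`
    have l1 : Real.log s + Real.log t = Real.log s' + Real.log t' := by
      rw [← Real.log_mul hs.1.ne' ht.1.ne', hst, Real.log_mul hs'.1.ne' ht'.1.ne']
    have l2 : Real.log (1 - s) + Real.log (1 - t) + Real.log (1 - w) =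
        Real.log (1 - s') + Real.log (1 - t') + Real.log (1 - w') := by
      rw [← Real.log_mul p1.ne' p2.ne', ← Real.log_mul (mul_pos p1 p2).ne' p3.ne',
        ← Real.log_mul p1'.ne' p2'.ne', ← Real.log_mul (mul_pos p1' p2').ne' p3'.ne']
      congr 1
      linear_combination q1 - q2 + hst
    have l3 : Real.log s + (Real.log w + (Real.log (1 - s) + Real.log (1 - t))) =
        Real.log s' + (Real.log w' + (Real.log (1 - s') + Real.log (1 - t'))) := by
      rw [← Real.log_mul p1.ne' p2.ne', ← Real.log_mul hw.1.ne' (mul_pos p1 p2).ne',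
        ← Real.log_mul hs.1.ne' (mul_pos hw.1 (mul_pos p1 p2)).ne',
        ← Real.log_mul p1'.ne' p2'.ne', ← Real.log_mul hw'.1.ne' (mul_pos p1' p2').ne',
        ← Real.log_mul hs'.1.ne' (mul_pos hw'.1 (mul_pos p1' p2')).ne', ← q1, ← q2]
      congr 1
      linear_combination -hst
    rw [hT]
    linear_combination key - (c₂ + g) * l1 + (g + c₁ - c₂) * l2 - (c₁ - c₂) * l3
  have hhalf : (1 / 2 : ℝ) ∈ Set.Ioo (0 : ℝ) 1 := ⟨by norm_num, by norm_num⟩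
  refine ⟨c₂ + g, -g - (c₁ - c₂), c₁ - c₂, kA₁, kA₂,
    fun i => B₃ i (1 / 2) - T (1 / 2) + (kB₁ + kB₂ - kA₁ - kA₂), fun s hs => ⟨?_, ?_, fun i => ?_⟩⟩
  · rw [hkA₁ s hs]; ring
  · rw [hkA₂ s hs]; ring
  · have h1 := hdiff i s hs _ hhalf
    have h2 : T s = (c₁ - c₂) * Real.log s + (-g - (c₁ - c₂)) * Real.log (1 - s) := rfl
    linear_combination h1 + h2

/-! ### From independence to a product density -/

/-- The averages of a function over small cubes around a point of continuity converge to its value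
there. -/
theorem tendsto_cube_average {g : ℝ → ℝ → ℝ → ℝ} {s t v : ℝ}
    (hg : ContinuousAt (fun p : ℝ × ℝ × ℝ => g p.1 p.2.1 p.2.2) (s, t, v)) {I J K : Set ℝ}
    (hI : I ∈ nhds s) (hJ : J ∈ nhds t) (hK : K ∈ nhds v) :
    Filter.Tendsto (fun ε : ℝ => (∫⁻ x in I ∩ Metric.ball s ε, ∫⁻ y in J ∩ Metric.ball t ε,
        ∫⁻ z in K ∩ Metric.ball v ε, ENNReal.ofReal (g x y z)) / ENNReal.ofReal (2 * ε) ^ 3)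
      (nhdsWithin 0 (Set.Ioi 0)) (nhds (ENNReal.ofReal (g s t v))) := by
  have hg' : Filter.Tendsto (fun p : ℝ × ℝ × ℝ => ENNReal.ofReal (g p.1 p.2.1 p.2.2))
      (nhds (s, t, v)) (nhds (ENNReal.ofReal (g s t v))) := ENNReal.tendsto_ofReal hg
  have hconst : ∀ (ε : ℝ) (c : ENNReal), 0 < ε → ∫⁻ _x in Metric.ball s ε,
      ∫⁻ _y in Metric.ball t ε, ∫⁻ _z in Metric.ball v ε, c = c * ENNReal.ofReal (2 * ε) ^ 3 := by
    intro ε c hε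
    simp only [setLIntegral_const, Real.volume_ball]
    ring
  have hev : ∀ p : ENNReal → Prop, (∀ᶠ q in nhds (s, t, v),
      p (ENNReal.ofReal (g q.1 q.2.1 q.2.2))) → ∀ᶠ ε in nhdsWithin (0 : ℝ) (Set.Ioi 0),
      0 < ε ∧ I ∩ Metric.ball s ε = Metric.ball s ε ∧ J ∩ Metric.ball t ε = Metric.ball t ε ∧
        K ∩ Metric.ball v ε = Metric.ball v ε ∧ ∀ x ∈ Metric.ball s ε, ∀ y ∈ Metric.ball t ε,
          ∀ z ∈ Metric.ball v ε, p (ENNReal.ofReal (g x y z)) := by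
    intro p hp
    obtain ⟨δ₀, h0, hδ₀⟩ := Metric.mem_nhds_iff.1 hp
    obtain ⟨δ₁, h1, hδ₁⟩ := Metric.mem_nhds_iff.1 hI
    obtain ⟨δ₂, h2, hδ₂⟩ := Metric.mem_nhds_iff.1 hJ
    obtain ⟨δ₃, h3, hδ₃⟩ := Metric.mem_nhds_iff.1 hK
    filter_upwards [Ioo_mem_nhdsGT h0, Ioo_mem_nhdsGT h1, Ioo_mem_nhdsGT h2, Ioo_mem_nhdsGT h3]
      with ε e0 e1 e2 e3
    refine ⟨e0.1, Set.inter_eq_right.2 ((Metric.ball_subset_ball e1.2.le).trans hδ₁),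
      Set.inter_eq_right.2 ((Metric.ball_subset_ball e2.2.le).trans hδ₂),
      Set.inter_eq_right.2 ((Metric.ball_subset_ball e3.2.le).trans hδ₃),
      fun x hx y hy z hz => ?_⟩
    refine @hδ₀ (x, y, z) ?_
    rw [← ball_prod_same, ← ball_prod_same]
    exact ⟨Metric.ball_subset_ball e0.2.le hx, Metric.ball_subset_ball e0.2.le hy,
      Metric.ball_subset_ball e0.2.le hz⟩
  refine tendsto_order.2 ⟨fun a ha => ?_, fun a ha => ?_⟩
  · obtain ⟨b, hab, hb⟩ := exists_between ha
    filter_upwards [hev (fun q => b < q) (hg'.eventually_const_lt hb)] with ε ⟨h0, h1, h2, h3, h4⟩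
    have hV : ENNReal.ofReal (2 * ε) ^ 3 ≠ 0 := pow_ne_zero _ (by simpa using h0)
    have hV' : ENNReal.ofReal (2 * ε) ^ 3 ≠ ⊤ := ENNReal.pow_ne_top ENNReal.ofReal_ne_top
    refine hab.trans_le ((ENNReal.le_div_iff_mul_le (Or.inl hV) (Or.inl hV')).2 ?_)
    rw [h1, h2, h3, ← hconst ε b h0]
    exact setLIntegral_mono' Metric.isOpen_ball.measurableSet fun x hx =>
      setLIntegral_mono' Metric.isOpen_ball.measurableSet fun y hy =>
      setLIntegral_mono' Metric.isOpen_ball.measurableSet fun z hz => (h4 x hx y hy z hz).le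
  · obtain ⟨b, hb, hab⟩ := exists_between ha
    filter_upwards [hev (fun q => q < b) (hg'.eventually_lt_const hb)] with ε ⟨h0, h1, h2, h3, h4⟩
    have hV : ENNReal.ofReal (2 * ε) ^ 3 ≠ 0 := pow_ne_zero _ (by simpa using h0)
    have hV' : ENNReal.ofReal (2 * ε) ^ 3 ≠ ⊤ := ENNReal.pow_ne_top ENNReal.ofReal_ne_top
    refine lt_of_le_of_lt ((ENNReal.div_le_iff_le_mul (Or.inl hV) (Or.inl hV')).2 ?_) hab
    rw [h1, h2, h3, ← hconst ε b h0]
    exact setLIntegral_mono' Metric.isOpen_ball.measurableSet fun x hx =>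
      setLIntegral_mono' Metric.isOpen_ball.measurableSet fun y hy =>
      setLIntegral_mono' Metric.isOpen_ball.measurableSet fun z hz => (h4 x hx y hy z hz).le

theorem differentiableAt_jac {s t : ℝ} (hs : s ∈ Set.Ioo (0 : ℝ) 1)
    (ht : t ∈ Set.Ioo (0 : ℝ) 1) :
    DifferentiableAt ℝ (fun p : ℝ × ℝ => jac p.1 p.2) (s, t) := by
  refine DifferentiableAt.sqrt (by fun_prop) ?_
  exact (mul_pos (mul_pos hs.1 (by linarith [hs.2])) (by linarith [ht.2])).ne'

theorem differentiableAt_chart {s t v : ℝ} (hs : s ∈ Set.Ioo (0 : ℝ) 1)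
    (ht : t ∈ Set.Ioo (0 : ℝ) 1) :
    DifferentiableAt ℝ (fun p : ℝ × ℝ × ℝ => chart p.1 p.2.1 p.2.2) (s, t, v) := by
  have h1 : DifferentiableAt ℝ (fun p : ℝ × ℝ × ℝ => jac p.1 p.2.1 * p.2.2) (s, t, v) := by
    refine DifferentiableAt.mul ?_ (by fun_prop)
    exact DifferentiableAt.comp (g := fun p : ℝ × ℝ => jac p.1 p.2)
      (f := fun p : ℝ × ℝ × ℝ => (p.1, p.2.1)) (s, t, v) (differentiableAt_jac hs ht)
      (by fun_prop)
  have h2 : DifferentiableAt ℝ (fun p : ℝ × ℝ × ℝ => p.1⁻¹) (s, t, v) :=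
    differentiableAt_fst.fun_inv hs.1.ne'
  have h3 := DifferentiableAt.fun_add (f := fun p : ℝ × ℝ × ℝ => p.2.1) (x := (s, t, v))
    (by fun_prop) ((h1.fun_pow 2).fun_mul h2)
  simp only [← div_eq_mul_inv] at h3
  exact DifferentiableAt.prodMk (by fun_prop) (h1.prodMk h3)

theorem jac_mul_jac {s t s' t' : ℝ} (hs : s ∈ Set.Ioo (0 : ℝ) 1) (hs' : s' ∈ Set.Ioo (0 : ℝ) 1) :
    jac s t * jac s' t' = jac s' t * jac s t' := by
  have h : ∀ r ∈ Set.Ioo (0 : ℝ) 1, 0 ≤ r * (1 - r) := fun r hr =>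
    mul_nonneg hr.1.le (by linarith [hr.2])
  simp only [jac, Real.sqrt_mul (h s hs), Real.sqrt_mul (h s' hs')]
  ring

theorem chart_mem_offDiag {s t v : ℝ} (hs : s ∈ Set.Ioo (0 : ℝ) 1) (ht : t ∈ Set.Ioo (0 : ℝ) 1)
    (hv : v ∈ Set.Ioo (-1 : ℝ) 1) (hv0 : v ≠ 0) : chart s t v ∈ offDiag :=
  (mem_offDiag_iff _).2 ⟨(sym_chart_mem_D2_iff hs ht).2 hv, mul_ne_zero (jac_pos hs ht).ne' hv0⟩

/-- If the first triplet is independent, then the density read in the chart takes values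
whose products do not change when one coordinate of two points is exchanged. -/
theorem density_exchange {Ω : Type*} [MeasurableSpace Ω] {μ : Measure Ω}
    {X : Ω → Mat2} {f : Mat2 → ℝ} (hX : Measurable X) (hlaw : μ.map X = lawOnD2 f)
    (hf : ContinuousOn (fun u => f (sym u)) offDiag) (hpos : ∀ u ∈ offDiag, 0 < f (sym u))
    (hind : iIndepFun (fun (i : Fin 3) (ω : Ω) => triplet1 (X ω) i) μ)
    {s s' t t' v v' : ℝ} (hs : s ∈ Set.Ioo (0 : ℝ) 1) (hs' : s' ∈ Set.Ioo (0 : ℝ) 1)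
    (ht : t ∈ Set.Ioo (0 : ℝ) 1) (ht' : t' ∈ Set.Ioo (0 : ℝ) 1)
    (hv : v ∈ Set.Ioo (-1 : ℝ) 1) (hv0 : v ≠ 0) (hv' : v' ∈ Set.Ioo (-1 : ℝ) 1) (hv0' : v' ≠ 0) :
    f (sym (chart s t v)) * f (sym (chart s' t' v')) =
        f (sym (chart s' t v)) * f (sym (chart s t' v')) ∧
      f (sym (chart s t v)) * f (sym (chart s' t' v')) =
        f (sym (chart s t' v)) * f (sym (chart s' t v')) := by
  set G : ℝ → ℝ → ℝ → ℝ := fun s t v => jac s t * f (sym (chart s t v)) with hG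
  set N : ℝ → ℝ → ℝ → ℝ → ENNReal := fun s t v ε =>
    ∫⁻ x in Set.Ioo (0 : ℝ) 1 ∩ Metric.ball s ε, ∫⁻ y in Set.Ioo (0 : ℝ) 1 ∩ Metric.ball t ε,
        ∫⁻ z in Set.Ioo (-1 : ℝ) 1 ∩ Metric.ball v ε, ENNReal.ofReal (G x y z) with hN
  set P : Fin 3 → ℝ → ℝ → ENNReal := fun i r ε =>
    μ ((fun ω => triplet1 (X ω) i) ⁻¹' Metric.ball r ε) with hP
  have hprod : ∀ s t v ε, N s t v ε = P 0 s ε * (P 1 t ε * P 2 v ε) := by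
    intro s t v ε
    have hb : ∀ r : ℝ, MeasurableSet (Metric.ball r ε) := fun r => Metric.isOpen_ball.measurableSet
    have h1 := lawOnD2_triplet1_mem hf (hb s) (hb t) (hb v)
    rw [← hlaw, Measure.map_apply hX
      (measurableSet_triplet1_mem (hb s) (hb t) (hb v))] at h1
    have h2 := hind.measure_inter_preimage_eq_mul Finset.univ
      (sets := ![Metric.ball s ε, Metric.ball t ε, Metric.ball v ε])
      (by intro i _; fin_cases i <;> exact hb _)
    rw [Fin.prod_univ_three] at h2
    rw [← mul_assoc]
    refine h1.symm.trans (Eq.trans ?_ h2)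
    congr 1
    ext ω
    simp [Fin.forall_fin_succ]
  have hlim : ∀ s t v, s ∈ Set.Ioo (0 : ℝ) 1 → t ∈ Set.Ioo (0 : ℝ) 1 → v ∈ Set.Ioo (-1 : ℝ) 1 →
      v ≠ 0 → Filter.Tendsto (fun ε => N s t v ε / ENNReal.ofReal (2 * ε) ^ 3)
        (nhdsWithin 0 (Set.Ioi 0)) (nhds (ENNReal.ofReal (G s t v))) := by
    intro s t v hs ht hv hv0
    refine tendsto_cube_average (g := G) ?_ (isOpen_Ioo.mem_nhds hs) (isOpen_Ioo.mem_nhds ht)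
      (isOpen_Ioo.mem_nhds hv)
    have h1 : ContinuousAt (fun p : ℝ × ℝ × ℝ => jac p.1 p.2.1) (s, t, v) :=
      ContinuousAt.comp (g := fun p : ℝ × ℝ => jac p.1 p.2)
        (f := fun p : ℝ × ℝ × ℝ => (p.1, p.2.1)) (differentiableAt_jac hs ht).continuousAt
        (by fun_prop)
    have h2 : ContinuousAt (fun u => f (sym u)) (chart s t v) :=
      hf.continuousAt (isOpen_offDiag.mem_nhds (chart_mem_offDiag hs ht hv hv0))
    exact h1.mul (ContinuousAt.comp (f := fun p : ℝ × ℝ × ℝ => chart p.1 p.2.1 p.2.2)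
      (g := fun u => f (sym u)) h2 (differentiableAt_chart hs ht).continuousAt)
  have hGpos : ∀ s t v, s ∈ Set.Ioo (0 : ℝ) 1 → t ∈ Set.Ioo (0 : ℝ) 1 → v ∈ Set.Ioo (-1 : ℝ) 1 →
      v ≠ 0 → 0 < G s t v := fun s t v hs ht hv hv0 =>
    mul_pos (jac_pos hs ht) (hpos _ (chart_mem_offDiag hs ht hv hv0))
  have hmul : ∀ s t v s' t' v', s ∈ Set.Ioo (0 : ℝ) 1 → t ∈ Set.Ioo (0 : ℝ) 1 →
      v ∈ Set.Ioo (-1 : ℝ) 1 → v ≠ 0 → s' ∈ Set.Ioo (0 : ℝ) 1 → t' ∈ Set.Ioo (0 : ℝ) 1 →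
      v' ∈ Set.Ioo (-1 : ℝ) 1 → v' ≠ 0 →
      Filter.Tendsto (fun ε => N s t v ε / ENNReal.ofReal (2 * ε) ^ 3 *
          (N s' t' v' ε / ENNReal.ofReal (2 * ε) ^ 3))
        (nhdsWithin 0 (Set.Ioi 0)) (nhds (ENNReal.ofReal (G s t v * G s' t' v'))) := by
    intro s t v s' t' v' hs ht hv hv0 hs' ht' hv' hv0'
    rw [ENNReal.ofReal_mul (hGpos s t v hs ht hv hv0).le]
    exact ENNReal.Tendsto.mul (hlim s t v hs ht hv hv0) (Or.inr ENNReal.ofReal_ne_top)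
      (hlim s' t' v' hs' ht' hv' hv0') (Or.inr ENNReal.ofReal_ne_top)
  have key : ∀ a a' : ℝ, 0 ≤ a → 0 ≤ a' → ENNReal.ofReal a = ENNReal.ofReal a' → a = a' :=
    fun a a' h h' e => (ENNReal.ofReal_eq_ofReal_iff h h').1 e
  have hj := jac_mul_jac (t := t) (t' := t') hs hs'
  have hj0 : jac s t * jac s' t' ≠ 0 := mul_ne_zero (jac_pos hs ht).ne' (jac_pos hs' ht').ne'
  have e1 : G s t v * G s' t' v' = G s' t v * G s t' v' := by
    refine key _ _ (mul_pos (hGpos _ _ _ hs ht hv hv0) (hGpos _ _ _ hs' ht' hv' hv0')).le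
      (mul_pos (hGpos _ _ _ hs' ht hv hv0) (hGpos _ _ _ hs ht' hv' hv0')).le ?_
    refine tendsto_nhds_unique (hmul s t v s' t' v' hs ht hv hv0 hs' ht' hv' hv0') ?_
    refine (hmul s' t v s t' v' hs' ht hv hv0 hs ht' hv' hv0').congr fun ε => ?_
    simp only [hprod, div_eq_mul_inv]
    ring
  have e2 : G s t v * G s' t' v' = G s t' v * G s' t v' := by
    refine key _ _ (mul_pos (hGpos _ _ _ hs ht hv hv0) (hGpos _ _ _ hs' ht' hv' hv0')).le
      (mul_pos (hGpos _ _ _ hs ht' hv hv0) (hGpos _ _ _ hs' ht hv' hv0')).le ?_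
    refine tendsto_nhds_unique (hmul s t v s' t' v' hs ht hv hv0 hs' ht' hv' hv0') ?_
    refine (hmul s t' v s' t v' hs ht' hv hv0 hs' ht hv' hv0').congr fun ε => ?_
    simp only [hprod, div_eq_mul_inv]
    ring
  constructor
  · apply mul_left_cancel₀ hj0
    simp only [hG] at e1
    linear_combination e1 - f (sym (chart s' t v)) * f (sym (chart s t' v')) * hj
  · apply mul_left_cancel₀ hj0
    simp only [hG] at e2
    linear_combination e2 - f (sym (chart s t' v)) * f (sym (chart s' t v')) * hj

/-! ### Exchanging the two diagonal entries -/

/-- The exchange of `x₁₁` and `x₂₂`. -/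
def swapDiag (x : Mat2) : Mat2 := !![x 1 1, x 0 1; x 0 1, x 0 0]

theorem swapDiag_sym (x y z : ℝ) : swapDiag (sym (x, y, z)) = sym (z, y, x) := by
  simp [swapDiag, sym]

theorem triplet1_swapDiag (x : Mat2) : triplet1 (swapDiag x) = triplet2 x := by
  simp [triplet1, triplet2, swapDiag, mul_comm (x 1 1)]

theorem measurable_swapDiag : Measurable swapDiag := by
  refine measurable_pi_lambda _ fun i => measurable_pi_lambda _ fun j => ?_
  fin_cases i <;> fin_cases j
  · exact measurable_entry 1 1
  · exact measurable_entry 0 1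
  · exact measurable_entry 0 1
  · exact measurable_entry 0 0

theorem mem_offDiag_swap {x y z : ℝ} : (z, y, x) ∈ offDiag ↔ (x, y, z) ∈ offDiag := by
  have h : ∀ x z : ℝ, (x, y, z) ∈ offDiag → (z, y, x) ∈ offDiag := by
    intro x z h
    rw [mem_offDiag_iff, sym_mem_D2_iff] at h ⊢
    obtain ⟨⟨⟨h1, h2⟩, h3, h4⟩, h5⟩ := h
    simp only at h1 h2 h3 h4 h5 ⊢
    refine ⟨⟨⟨?_, by linarith⟩, ?_, by linarith⟩, h5⟩
    · by_contra hc
      nlinarith [sq_nonneg y]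
    · by_contra hc
      nlinarith [sq_nonneg y]
  exact ⟨h z x, h x z⟩

theorem measurePreserving_swap_outer :
    MeasurePreserving (fun u : ℝ × ℝ × ℝ => (u.2.2, u.2.1, u.1)) volume volume := by
  have h1 : MeasurePreserving (Prod.swap : ℝ × (ℝ × ℝ) → (ℝ × ℝ) × ℝ) volume volume :=
    Measure.measurePreserving_swap
  have h2 : MeasurePreserving (Prod.map Prod.swap id : (ℝ × ℝ) × ℝ → (ℝ × ℝ) × ℝ)
      volume volume :=
    (Measure.measurePreserving_swap (μ := (volume : Measure ℝ)) (ν := (volume : Measure ℝ))).prod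
      (MeasurePreserving.id volume)
  have h3 : MeasurePreserving (MeasurableEquiv.prodAssoc : (ℝ × ℝ) × ℝ ≃ᵐ ℝ × ℝ × ℝ)
      volume volume := volume_preserving_prodAssoc
  exact h3.comp (h2.comp h1)

theorem lawOnD2_map_swapDiag (f : Mat2 → ℝ) :
    (lawOnD2 f).map swapDiag = lawOnD2 fun x => f (swapDiag x) := by
  ext A hA
  rw [Measure.map_apply measurable_swapDiag hA, lawOnD2_apply f (measurable_swapDiag hA),
    lawOnD2_apply _ hA]
  have he : MeasurableEmbedding (fun u : ℝ × ℝ × ℝ => (u.2.2, u.2.1, u.1)) :=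
    MeasurableEmbedding.of_measurable_inverse (g := fun u : ℝ × ℝ × ℝ => (u.2.2, u.2.1, u.1))
      (by fun_prop) (by
        rw [Set.range_eq_univ.2 fun u => ⟨(u.2.2, u.2.1, u.1), rfl⟩]
        exact MeasurableSet.univ) (by fun_prop) (fun u => rfl)
  rw [← measurePreserving_swap_outer.lintegral_comp_emb he]
  refine lintegral_congr fun ⟨x, y, z⟩ => ?_
  have e1 : swapDiag (sym (z, y, x)) = sym (x, y, z) := swapDiag_sym z y x
  by_cases h1 : (x, y, z) ∈ offDiag <;> by_cases h2 : sym (x, y, z) ∈ A <;>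
    simp [Set.indicator, h1, h2, mem_offDiag_swap, e1, swapDiag_sym]

/-! ### The density is a product of powers -/

/-- The members of the family before normalization. -/
noncomputable def powerDensity (a b c : ℝ) (x : Mat2) : ℝ :=
  x.det ^ (a - 1) * (1 - x).det ^ (b - 1) * |x 0 1| ^ (2 * c - 1)

/-- The sign attached to the two halves `0 < x₁₂` and `x₁₂ < 0` of `D₂`. -/
def halfSign (i : Bool) : ℝ := if i then 1 else -1

theorem halfSign_sq (i : Bool) : halfSign i ^ 2 = 1 := by
  cases i <;> simp [halfSign]

theorem halfSign_mul_sqrt_mem {w : ℝ} (hw : w ∈ Set.Ioo (0 : ℝ) 1) (i : Bool) :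
    halfSign i * √w ∈ Set.Ioo (-1 : ℝ) 1 ∧ halfSign i * √w ≠ 0 := by
  have h1 : 0 < √w := Real.sqrt_pos.2 hw.1
  have h2 : √w < 1 := (Real.sqrt_lt' one_pos).2 (by simpa using hw.2)
  cases i
  · simp only [halfSign, Bool.false_eq_true, if_false, Set.mem_Ioo]
    exact ⟨⟨by linarith, by linarith⟩, by linarith⟩
  · simp only [halfSign, if_true, Set.mem_Ioo]
    exact ⟨⟨by linarith, by linarith⟩, by linarith⟩

/-- Independence of the first triplet makes the logarithm of the density additively separable
in the chart, with the first two summands common to both halves of `D₂`. -/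
theorem exists_log_density_eq_add {Ω : Type*} [MeasurableSpace Ω] {μ : Measure Ω}
    {X : Ω → Mat2} {f : Mat2 → ℝ} (hX : Measurable X) (hlaw : μ.map X = lawOnD2 f)
    (hf : DifferentiableOn ℝ (fun u => f (sym u)) offDiag) (hpos : ∀ u ∈ offDiag, 0 < f (sym u))
    (hind : iIndepFun (fun (i : Fin 3) (ω : Ω) => triplet1 (X ω) i) μ) :
    ∃ (A₁ A₂ : ℝ → ℝ) (A₃ : Bool → ℝ → ℝ),
      (∀ s ∈ Set.Ioo (0 : ℝ) 1, DifferentiableAt ℝ A₁ s) ∧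
      (∀ s ∈ Set.Ioo (0 : ℝ) 1, DifferentiableAt ℝ A₂ s) ∧
      (∀ i, ∀ s ∈ Set.Ioo (0 : ℝ) 1, DifferentiableAt ℝ (A₃ i) s) ∧
      ∀ s ∈ Set.Ioo (0 : ℝ) 1, ∀ t ∈ Set.Ioo (0 : ℝ) 1, ∀ w ∈ Set.Ioo (0 : ℝ) 1, ∀ i,
        Real.log (f (sym (chart s t (halfSign i * √w)))) = A₁ s + A₂ t + A₃ i w := by
  set H : ℝ → ℝ → ℝ → ℝ := fun s t v => f (sym (chart s t v)) with hH
  have hh : (1 / 2 : ℝ) ∈ Set.Ioo (0 : ℝ) 1 := ⟨by norm_num, by norm_num⟩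
  have hh' : (1 / 2 : ℝ) ∈ Set.Ioo (-1 : ℝ) 1 := ⟨by norm_num, by norm_num⟩
  have hh0 : (1 / 2 : ℝ) ≠ 0 := by norm_num
  have hHpos : ∀ {s t v}, s ∈ Set.Ioo (0 : ℝ) 1 → t ∈ Set.Ioo (0 : ℝ) 1 →
      v ∈ Set.Ioo (-1 : ℝ) 1 → v ≠ 0 → 0 < H s t v := fun hs ht hv hv0 =>
    hpos _ (chart_mem_offDiag hs ht hv hv0)
  have hHd : ∀ {s t v}, s ∈ Set.Ioo (0 : ℝ) 1 → t ∈ Set.Ioo (0 : ℝ) 1 →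
      v ∈ Set.Ioo (-1 : ℝ) 1 → v ≠ 0 →
      DifferentiableAt ℝ (fun p : ℝ × ℝ × ℝ => Real.log (H p.1 p.2.1 p.2.2)) (s, t, v) := by
    intro s t v hs ht hv hv0
    refine DifferentiableAt.log ?_ (hHpos hs ht hv hv0).ne'
    have h2 : DifferentiableAt ℝ (fun u => f (sym u)) (chart s t v) :=
      hf.differentiableAt (isOpen_offDiag.mem_nhds (chart_mem_offDiag hs ht hv hv0))
    exact DifferentiableAt.comp (f := fun p : ℝ × ℝ × ℝ => chart p.1 p.2.1 p.2.2)
      (g := fun u => f (sym u)) (s, t, v) h2 (differentiableAt_chart hs ht)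
  refine ⟨fun s => Real.log (H s (1 / 2) (1 / 2)), fun t => Real.log (H (1 / 2) t (1 / 2)),
    fun i w => Real.log (H (1 / 2) (1 / 2) (halfSign i * √w)) -
      2 * Real.log (H (1 / 2) (1 / 2) (1 / 2)), fun s hs => ?_, fun t ht => ?_,
    fun i w hw => ?_, fun s hs t ht w hw i => ?_⟩
  · exact DifferentiableAt.comp (f := fun s : ℝ => (s, ((1 / 2 : ℝ), (1 / 2 : ℝ))))
      (g := fun p : ℝ × ℝ × ℝ => Real.log (H p.1 p.2.1 p.2.2)) s (hHd hs hh hh' hh0) (by fun_prop)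
  · exact DifferentiableAt.comp (f := fun s : ℝ => ((1 / 2 : ℝ), s, (1 / 2 : ℝ)))
      (g := fun p : ℝ × ℝ × ℝ => Real.log (H p.1 p.2.1 p.2.2)) t (hHd hh ht hh' hh0) (by fun_prop)
  · obtain ⟨hv, hv0⟩ := halfSign_mul_sqrt_mem hw i
    refine DifferentiableAt.sub_const ?_ _
    refine DifferentiableAt.comp (f := fun s : ℝ => ((1 / 2 : ℝ), (1 / 2 : ℝ), halfSign i * √s))
      (g := fun p : ℝ × ℝ × ℝ => Real.log (H p.1 p.2.1 p.2.2)) w (hHd hh hh hv hv0) ?_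
    have h1 : DifferentiableAt ℝ (fun s : ℝ => halfSign i * √s) w :=
      (differentiableAt_id.sqrt hw.1.ne').const_mul _
    exact (differentiableAt_const _).prodMk ((differentiableAt_const _).prodMk h1)
  · obtain ⟨hv, hv0⟩ := halfSign_mul_sqrt_mem hw i
    beta_reduce
    generalize halfSign i * √w = v at hv hv0 ⊢
    have hcont := hf.continuousOn
    have e1 := (density_exchange hX hlaw hcont hpos hind hs hh ht hh hv hv0 hh' hh0).1
    have e2 := (density_exchange hX hlaw hcont hpos hind hh hh ht hh hv hv0 hh' hh0).2
    have l1 := congrArg Real.log e1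
    have l2 := congrArg Real.log e2
    have p0 := hHpos hh hh hh' hh0
    rw [Real.log_mul (hHpos hs ht hv hv0).ne' p0.ne',
      Real.log_mul (hHpos hh ht hv hv0).ne' (hHpos hs hh hh' hh0).ne'] at l1
    rw [Real.log_mul (hHpos hh ht hv hv0).ne' p0.ne',
      Real.log_mul (hHpos hh hh hv hv0).ne' (hHpos hh ht hh' hh0).ne'] at l2
    simp only [hH]
    linarith

theorem exists_chart_eq {u : ℝ × ℝ × ℝ} (hu : sym u ∈ D2) :
    ∃ s ∈ Set.Ioo (0 : ℝ) 1, ∃ t ∈ Set.Ioo (0 : ℝ) 1, ∃ v ∈ Set.Ioo (-1 : ℝ) 1,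
      chart s t v = u := by
  obtain ⟨hs, ht, hchart⟩ := chart_triplet hu
  exact ⟨_, hs, _, ht, _, (sym_chart_mem_D2_iff hs ht).1 (by rw [hchart]; exact hu), hchart⟩

/-- The matrix with first triplet `(s, t, ±√w)`, where `w` is the argument of `A₃` in
`TripletEquation`, has diagonal `(s, s')`. -/
theorem chart_third_sq {s t s' : ℝ} (hs : s ∈ Set.Ioo (0 : ℝ) 1) (ht : t ∈ Set.Ioo (0 : ℝ) 1)
    (i : Bool) (h : t < s') :
    chart s t (halfSign i * √((s' - t) / ((1 - s) * (1 - t)))) =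
      (s, halfSign i * √(s * s' - s * t), s') := by
  have p1 : 0 < 1 - s := by linarith [hs.2]
  have p2 : 0 < 1 - t := by linarith [ht.2]
  have e : jac s t * (halfSign i * √((s' - t) / ((1 - s) * (1 - t)))) =
      halfSign i * √(s * s' - s * t) := by
    rw [mul_left_comm, jac, ← Real.sqrt_mul (mul_nonneg (mul_nonneg hs.1.le p1.le) p2.le)]
    congr 2
    field_simp
  have h0 : 0 ≤ s * s' - s * t := by nlinarith [hs.1]
  have hs0 := hs.1.ne'
  rw [chart, e, mul_pow, halfSign_sq, Real.sq_sqrt h0]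
  congr 2
  field_simp
  ring

/-- Both independences force the density to be a product of powers of `det x`, `det (1 - x)`
and `|x₁₂|` on each half of `D₂`, with the same exponents. -/
theorem exists_eq_const_mul_powerDensity {Ω : Type*} [MeasurableSpace Ω] {μ : Measure Ω}
    {X : Ω → Mat2} {f : Mat2 → ℝ} (hX : Measurable X) (hlaw : μ.map X = lawOnD2 f)
    (hf : DifferentiableOn ℝ (fun u => f (sym u)) offDiag) (hpos : ∀ u ∈ offDiag, 0 < f (sym u))
    (hind : TripletIndep μ X) :
    ∃ (a b c k l : ℝ), 0 < k ∧ 0 < l ∧ ∀ u ∈ offDiag,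
      f (sym u) = (if 0 < u.2.1 then k else l) * powerDensity a b c (sym u) := by
  obtain ⟨A₁, A₂, A₃, hA₁, hA₂, hA₃, hA⟩ := exists_log_density_eq_add hX hlaw hf hpos hind.1
  have hlaw' : μ.map (fun ω => swapDiag (X ω)) = lawOnD2 fun x => f (swapDiag x) := by
    rw [← lawOnD2_map_swapDiag, ← hlaw, Measure.map_map measurable_swapDiag hX]
    rfl
  have hswap : ∀ u : ℝ × ℝ × ℝ, f (swapDiag (sym u)) = f (sym (u.2.2, u.2.1, u.1)) := fun u => by
    rw [swapDiag_sym u.1 u.2.1 u.2.2]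
  have hf' : DifferentiableOn ℝ (fun u => f (swapDiag (sym u))) offDiag := by
    simp only [hswap]
    exact DifferentiableOn.comp (g := fun u => f (sym u))
      (f := fun u : ℝ × ℝ × ℝ => (u.2.2, u.2.1, u.1)) hf (by fun_prop)
      (fun u hu => mem_offDiag_swap.2 hu)
  have hpos' : ∀ u ∈ offDiag, 0 < f (swapDiag (sym u)) := fun u hu => by
    rw [hswap]
    exact hpos _ (mem_offDiag_swap.2 hu)
  have hind' : iIndepFun (fun (i : Fin 3) (ω : Ω) => triplet1 (swapDiag (X ω)) i) μ := by
    simp only [triplet1_swapDiag]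
    exact hind.2
  obtain ⟨B₁, B₂, B₃, hB₁, hB₂, hB₃, hB⟩ :=
    exists_log_density_eq_add (measurable_swapDiag.comp hX) hlaw' hf' hpos' hind'
  have hfe : ∀ i, TripletEquation A₁ A₂ (A₃ i) B₁ B₂ (B₃ i) := by
    intro i s t s' t' hs ht hs' ht' hst h1 h2
    have h1' : t' < s := by
      by_contra hcon
      nlinarith [mul_pos ht.1 hs.1, hs'.1, ht'.1, hs.1, ht.1]
    have hw := third_sq_mem_Ioo hs.2 ht.2 h1 h2
    have hw' := third_sq_mem_Ioo hs'.2 ht'.2 h1' (by rw [← hst]; linarith)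
    rw [← hA s hs t ht _ hw i, ← hB s' hs' t' ht' _ hw' i, chart_third_sq hs ht i h1,
      chart_third_sq hs' ht' i h1', swapDiag_sym, hst, mul_comm s' s]
  obtain ⟨α, β, γ, k₁, k₂, k, hsol⟩ :=
    TripletEquation.exists_solution hfe hA₁ hA₂ hA₃ hB₁ hB₂ hB₃
  refine ⟨α + 1, β + 1, γ + 1 / 2, Real.exp (k₁ + k₂ + k true), Real.exp (k₁ + k₂ + k false),
    Real.exp_pos _, Real.exp_pos _, fun u hu => ?_⟩
  obtain ⟨huD, hu0⟩ := (mem_offDiag_iff u).1 hu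
  obtain ⟨s, hs, t, ht, v, hv, hchart⟩ := exists_chart_eq huD
  have hj := jac_pos hs ht
  have hy : u.2.1 = jac s t * v := by rw [← hchart]; rfl
  have hv0 : v ≠ 0 := by rintro rfl; exact hu0 (by rw [hy, mul_zero])
  have hw : v ^ 2 ∈ Set.Ioo (0 : ℝ) 1 :=
    ⟨by positivity, (sq_lt_one_iff_abs_lt_one v).2 (abs_lt.2 hv)⟩
  obtain ⟨i, hi, hK⟩ : ∃ i, halfSign i * √(v ^ 2) = v ∧
      (if 0 < u.2.1 then Real.exp (k₁ + k₂ + k true) else Real.exp (k₁ + k₂ + k false)) =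
        Real.exp (k₁ + k₂ + k i) := by
    have hiff : 0 < u.2.1 ↔ 0 < v := by rw [hy, mul_pos_iff_of_pos_left hj]
    rw [Real.sqrt_sq_eq_abs]
    rcases lt_or_gt_of_ne hv0 with h | h
    · exact ⟨false, by simp [halfSign, abs_of_neg h], if_neg fun h' => h.not_gt (hiff.1 h')⟩
    · exact ⟨true, by simp [halfSign, abs_of_pos h], if_pos (hiff.2 h)⟩
  have hlog := hA s hs t ht _ hw i
  rw [hi, hchart, (hsol s hs).1, (hsol t ht).2.1, (hsol _ hw).2.2 i] at hlog
  have p1 : 0 < 1 - s := by linarith [hs.2]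
  have p2 : 0 < 1 - t := by linarith [ht.2]
  have p3 : 0 < 1 - v ^ 2 := by linarith [hw.2]
  have d1 : (sym u).det = s * t := by rw [det_sym, ← hchart, det_chart hs]
  have d2 : (1 - sym u).det = (1 - s) * (1 - t) * (1 - v ^ 2) := by
    rw [det_one_sub_sym, ← hchart, det_one_sub_chart hs ht]
  have d3 : sym u 0 1 ^ 2 = s * (1 - s) * (1 - t) * v ^ 2 := by
    rw [← jac_sq hs ht, ← mul_pow, ← hchart]; rfl
  have d4 : 0 < |sym u 0 1| := abs_pos.2 hu0
  have l4 : 2 * Real.log |sym u 0 1| =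
      Real.log s + Real.log (1 - s) + Real.log (1 - t) + Real.log (v ^ 2) := by
    rw [← Real.log_mul hs.1.ne' p1.ne', ← Real.log_mul (mul_pos hs.1 p1).ne' p2.ne',
      ← Real.log_mul (mul_pos (mul_pos hs.1 p1) p2).ne' hw.1.ne', ← d3, ← sq_abs, Real.log_pow]
    norm_num
  rw [hK, powerDensity, d1, d2, Real.rpow_def_of_pos (mul_pos hs.1 ht.1),
    Real.rpow_def_of_pos (mul_pos (mul_pos p1 p2) p3), Real.rpow_def_of_pos d4,
    ← Real.exp_add, ← Real.exp_add, ← Real.exp_add, ← Real.exp_log (hpos u hu), hlog,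
    Real.log_mul hs.1.ne' ht.1.ne', Real.log_mul (mul_pos p1 p2).ne' p3.ne',
    Real.log_mul p1.ne' p2.ne']
  congr 1
  linear_combination -γ * l4

/-! ### Beta integrals -/

/-- The beta density on `(0, 1)` before normalization. -/
noncomputable def betaWeight (p q s : ℝ) : ℝ := s ^ (p - 1) * (1 - s) ^ (q - 1)

theorem betaWeight_pos {s : ℝ} (p q : ℝ) (hs : s ∈ Set.Ioo (0 : ℝ) 1) : 0 < betaWeight p q s :=
  mul_pos (Real.rpow_pos_of_pos hs.1 _) (Real.rpow_pos_of_pos (by linarith [hs.2]) _)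

theorem measurable_betaWeight (p q : ℝ) : Measurable (betaWeight p q) := by
  unfold betaWeight
  fun_prop

/-- The Euler integral with arbitrary real parameters, possibly infinite. -/
noncomputable def betaLIntegral (p q : ℝ) : ENNReal :=
  ∫⁻ s in Set.Ioo (0 : ℝ) 1, ENNReal.ofReal (betaWeight p q s)

theorem betaLIntegral_eq {p q : ℝ} (hp : 0 < p) (hq : 0 < q) :
    betaLIntegral p q = ENNReal.ofReal (beta p q) := by
  have hb := beta_pos hp hq
  have h1 : ENNReal.ofReal (1 / beta p q) * betaLIntegral p q = 1 := by
    rw [← lintegral_betaPDF_eq_one hp hq, lintegral_betaPDF, betaLIntegral,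
      ← lintegral_const_mul' _ _ ENNReal.ofReal_ne_top]
    refine lintegral_congr fun s => ?_
    rw [← ENNReal.ofReal_mul (by positivity), betaWeight, mul_assoc]
  calc betaLIntegral p q = ENNReal.ofReal (beta p q) *
        (ENNReal.ofReal (1 / beta p q) * betaLIntegral p q) := by
        rw [← mul_assoc, ← ENNReal.ofReal_mul hb.le, mul_one_div_cancel hb.ne',
          ENNReal.ofReal_one, one_mul]
    _ = ENNReal.ofReal (beta p q) := by rw [h1, mul_one]

theorem betaLIntegral_ne_zero (p q : ℝ) : betaLIntegral p q ≠ 0 := by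
  refine ((setLIntegral_pos_iff (measurable_betaWeight p q).ennreal_ofReal).2 ?_).ne'
  have : Set.Ioo (0 : ℝ) 1 ⊆ Function.support fun s => ENNReal.ofReal (betaWeight p q s) :=
    fun s hs => by simpa using betaWeight_pos p q hs
  rw [Set.inter_eq_right.2 this]
  simp

theorem betaLIntegral_comm (p q : ℝ) : betaLIntegral p q = betaLIntegral q p := by
  have him : (fun s : ℝ => 1 - s) '' Set.Ioo 0 1 = Set.Ioo 0 1 := by
    rw [Set.image_const_sub_Ioo]; norm_num
  have h := lintegral_image_eq_lintegral_abs_deriv_mul (s := Set.Ioo (0 : ℝ) 1)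
    (f := fun s : ℝ => 1 - s) (f' := fun _ => -1) measurableSet_Ioo
    (fun x _ => ((hasDerivAt_id x).const_sub 1).hasDerivWithinAt)
    (fun x _ y _ h => by simpa using h) (fun s => ENNReal.ofReal (betaWeight p q s))
  rw [him] at h
  rw [betaLIntegral, h, betaLIntegral]
  refine lintegral_congr fun s => ?_
  simp [betaWeight, mul_comm]

theorem pos_of_betaLIntegral_ne_top_left {p q : ℝ} (h : betaLIntegral p q ≠ ⊤) : 0 < p := by
  set m : ℝ := min 1 ((1 / 2) ^ (q - 1)) with hm
  have hm0 : 0 < m := by positivity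
  -- on `(0, 1 / 2)` the factor `(1 - s) ^ (q - 1)` is bounded below
  have hle : ∀ s ∈ Set.Ioo (0 : ℝ) (1 / 2), m * s ^ (p - 1) ≤ betaWeight p q s := by
    intro s hs
    rw [betaWeight, mul_comm]
    refine mul_le_mul_of_nonneg_left ?_ (Real.rpow_nonneg hs.1.le _)
    have h1 : 0 < 1 - s := by linarith [hs.2]
    rcases le_total 0 (q - 1) with hq | hq
    · exact (min_le_right _ _).trans
        (Real.rpow_le_rpow (by norm_num) (by linarith [hs.2]) hq)
    · exact (min_le_left _ _).trans (Real.one_le_rpow_of_pos_of_le_one_of_nonpos h1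
        (by linarith [hs.1]) hq)
  have h1 : ENNReal.ofReal m * ∫⁻ s in Set.Ioo (0 : ℝ) (1 / 2), ENNReal.ofReal (s ^ (p - 1)) ≤
      betaLIntegral p q := by
    rw [← lintegral_const_mul' _ _ ENNReal.ofReal_ne_top]
    refine (setLIntegral_mono' measurableSet_Ioo fun s hs => ?_).trans
      (lintegral_mono_set (Set.Ioo_subset_Ioo_right (by norm_num)))
    rw [← ENNReal.ofReal_mul hm0.le]
    exact ENNReal.ofReal_le_ofReal (hle s hs)
  have h2 : ∫⁻ s in Set.Ioo (0 : ℝ) (1 / 2), ENNReal.ofReal (s ^ (p - 1)) ≠ ⊤ := by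
    intro htop
    rw [htop, ENNReal.mul_top (by simpa using hm0)] at h1
    exact h (top_le_iff.1 h1)
  have h3 : IntegrableOn (fun s : ℝ => s ^ (p - 1)) (Set.Ioo 0 (1 / 2)) := by
    refine ⟨(by fun_prop : Measurable fun s : ℝ => s ^ (p - 1)).aestronglyMeasurable, ?_⟩
    rw [hasFiniteIntegral_iff_ofReal]
    · exact lt_top_iff_ne_top.2 h2
    · filter_upwards [ae_restrict_mem measurableSet_Ioo] with s hs
      exact Real.rpow_nonneg hs.1.le _
  have := (intervalIntegral.integrableOn_Ioo_rpow_iff (by norm_num)).1 h3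
  linarith

theorem pos_of_betaLIntegral_ne_top {p q : ℝ} (h : betaLIntegral p q ≠ ⊤) : 0 < p ∧ 0 < q :=
  ⟨pos_of_betaLIntegral_ne_top_left h,
    pos_of_betaLIntegral_ne_top_left (by rwa [betaLIntegral_comm])⟩

/-- The unnormalized law of the third component of the triplet. -/
noncomputable def thirdWeight (b c v : ℝ) : ℝ := |v| ^ (2 * c - 1) * (1 - v ^ 2) ^ (b - 1)

theorem two_mul_lintegral_thirdWeight (b c : ℝ) :
    2 * ∫⁻ v in Set.Ioo (0 : ℝ) 1, ENNReal.ofReal (thirdWeight b c v) = betaLIntegral c b := by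
  have him : (fun v : ℝ => v ^ 2) '' Set.Ioo 0 1 = Set.Ioo 0 1 := by
    ext w
    constructor
    · rintro ⟨v, hv, rfl⟩
      exact ⟨pow_pos hv.1 2, pow_lt_one₀ hv.1.le hv.2 two_ne_zero⟩
    · intro hw
      exact ⟨√w, ⟨Real.sqrt_pos.2 hw.1, (Real.sqrt_lt' one_pos).2 (by simpa using hw.2)⟩,
        Real.sq_sqrt hw.1.le⟩
  have h := lintegral_image_eq_lintegral_abs_deriv_mul (s := Set.Ioo (0 : ℝ) 1)
    (f := fun v : ℝ => v ^ 2) (f' := fun v => 2 * v) measurableSet_Ioo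
    (fun x _ => by simpa using (hasDerivAt_pow 2 x).hasDerivWithinAt)
    (fun x hx y hy h => (sq_eq_sq₀ hx.1.le hy.1.le).1 h)
    (fun s => ENNReal.ofReal (betaWeight c b s))
  rw [him] at h
  rw [betaLIntegral, h, ← lintegral_const_mul' _ _ (by simp)]
  refine setLIntegral_congr_fun measurableSet_Ioo fun v hv => ?_
  have h2 : (2 : ENNReal) = ENNReal.ofReal 2 := by simp
  rw [h2, ← ENNReal.ofReal_mul (by norm_num), ← ENNReal.ofReal_mul (abs_nonneg _),
    abs_of_pos (by linarith [hv.1] : (0 : ℝ) < 2 * v), thirdWeight, betaWeight, abs_of_pos hv.1]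
  congr 1
  have e : v ^ (2 * c - 1) = v * (v ^ 2) ^ (c - 1) :=
    calc v ^ (2 * c - 1) = v ^ (1 + ((2 : ℕ) : ℝ) * (c - 1)) := by congr 1; push_cast; ring
      _ = _ := by rw [Real.rpow_add hv.1, Real.rpow_one, Real.rpow_natCast_mul hv.1.le]
  rw [e]
  ring

theorem two_mul_lintegral_signed_thirdWeight (b c : ℝ) {k l : ℝ} (hk : 0 ≤ k) (hl : 0 ≤ l) :
    2 * ∫⁻ v in Set.Ioo (-1 : ℝ) 1,
        ENNReal.ofReal ((if 0 < v then k else l) * thirdWeight b c v) =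
      (ENNReal.ofReal k + ENNReal.ofReal l) * betaLIntegral c b := by
  have h1 : ∫⁻ v in Set.Ioo (-1 : ℝ) 1 ∩ Set.Ioi 0,
      ENNReal.ofReal ((if 0 < v then k else l) * thirdWeight b c v) =
      ENNReal.ofReal k * ∫⁻ v in Set.Ioo (0 : ℝ) 1, ENNReal.ofReal (thirdWeight b c v) := by
    have : Set.Ioo (-1 : ℝ) 1 ∩ Set.Ioi 0 = Set.Ioo 0 1 := by
      ext v
      simp only [Set.mem_inter_iff, Set.mem_Ioo, Set.mem_Ioi]
      constructor
      · rintro ⟨⟨-, h⟩, h'⟩; exact ⟨h', h⟩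
      · rintro ⟨h, h'⟩; exact ⟨⟨by linarith, h'⟩, h⟩
    rw [this, ← lintegral_const_mul' _ _ ENNReal.ofReal_ne_top]
    refine setLIntegral_congr_fun measurableSet_Ioo fun v hv => ?_
    simp only [if_pos hv.1, ENNReal.ofReal_mul hk]
  have h2 : ∫⁻ v in Set.Ioo (-1 : ℝ) 1 \ Set.Ioi 0,
      ENNReal.ofReal ((if 0 < v then k else l) * thirdWeight b c v) =
      ENNReal.ofReal l * ∫⁻ v in Set.Ioo (0 : ℝ) 1, ENNReal.ofReal (thirdWeight b c v) := by
    have hset : Set.Ioo (-1 : ℝ) 1 \ Set.Ioi 0 = Set.Ioc (-1) 0 := by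
      ext v
      simp only [Set.mem_sdiff, Set.mem_Ioo, Set.mem_Ioi, not_lt, Set.mem_Ioc]
      constructor
      · rintro ⟨⟨h, -⟩, h'⟩; exact ⟨h, h'⟩
      · rintro ⟨h, h'⟩; exact ⟨⟨h, by linarith⟩, h'⟩
    have him : (fun s : ℝ => -s) '' Set.Ioo 0 1 = Set.Ioo (-1) 0 := by
      rw [Set.image_neg_Ioo]; norm_num
    have h := lintegral_image_eq_lintegral_abs_deriv_mul (s := Set.Ioo (0 : ℝ) 1)
      (f := fun s : ℝ => -s) (f' := fun _ => -1) measurableSet_Ioo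
      (fun x _ => (hasDerivAt_id x).fun_neg.hasDerivWithinAt)
      (fun x _ y _ h => by simpa using h)
      (fun v => ENNReal.ofReal ((if 0 < v then k else l) * thirdWeight b c v))
    rw [him] at h
    rw [hset, ← setLIntegral_congr Ioo_ae_eq_Ioc, h,
      ← lintegral_const_mul' _ _ ENNReal.ofReal_ne_top]
    refine setLIntegral_congr_fun measurableSet_Ioo fun v hv => ?_
    have hneg : ¬ 0 < -v := by linarith [hv.1]
    simp [hneg, ENNReal.ofReal_mul hl, thirdWeight]
  rw [← lintegral_inter_add_sdiff _ (Set.Ioo (-1 : ℝ) 1) measurableSet_Ioi, h1, h2,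
    ← two_mul_lintegral_thirdWeight b c]
  ring

/-! ### The law of the triplets for a product of powers -/

theorem jac_mul_powerDensity_chart {s t v : ℝ} (a b c : ℝ) (hs : s ∈ Set.Ioo (0 : ℝ) 1)
    (ht : t ∈ Set.Ioo (0 : ℝ) 1) (hv : v ∈ Set.Ioo (-1 : ℝ) 1) (hv0 : v ≠ 0) :
    jac s t * powerDensity a b c (sym (chart s t v)) =
      betaWeight (a + c) (b + c) s * betaWeight a (b + c) t * thirdWeight b c v := by
  have p1 : 0 < 1 - s := by linarith [hs.2]
  have p2 : 0 < 1 - t := by linarith [ht.2]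
  have p3 : 0 < 1 - v ^ 2 := by
    have := (sq_lt_one_iff_abs_lt_one v).2 (abs_lt.2 hv)
    linarith
  have hj := jac_pos hs ht
  have d3 : sym (chart s t v) 0 1 = jac s t * v := rfl
  have p4 : 0 < |v| := abs_pos.2 hv0
  have lj : 2 * Real.log (jac s t) = Real.log s + Real.log (1 - s) + Real.log (1 - t) := by
    rw [← Real.log_mul hs.1.ne' p1.ne', ← Real.log_mul (mul_pos hs.1 p1).ne' p2.ne',
      ← jac_sq hs ht, Real.log_pow]
    norm_num
  have hjexp := Real.exp_log hj
  rw [powerDensity, det_sym, det_chart hs, det_one_sub_sym, det_one_sub_chart hs ht, d3, abs_mul,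
    abs_of_pos hj, betaWeight, betaWeight, thirdWeight,
    Real.rpow_def_of_pos (mul_pos hs.1 ht.1), Real.rpow_def_of_pos (mul_pos (mul_pos p1 p2) p3),
    Real.rpow_def_of_pos (mul_pos hj p4), Real.rpow_def_of_pos hs.1, Real.rpow_def_of_pos ht.1,
    Real.rpow_def_of_pos p1, Real.rpow_def_of_pos p2, Real.rpow_def_of_pos p3,
    Real.rpow_def_of_pos p4]
  nth_rewrite 1 [← hjexp]
  simp only [← Real.exp_add]
  rw [Real.log_mul hs.1.ne' ht.1.ne', Real.log_mul (mul_pos p1 p2).ne' p3.ne',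
    Real.log_mul p1.ne' p2.ne', Real.log_mul hj.ne' p4.ne']
  congr 1
  linear_combination c * lj

/-- If the density is a product of powers on each half of `D₂`, then the law of the first triplet
is a product. -/
theorem lawOnD2_triplet1_mem_eq_mul {a b c k l : ℝ} {f : Mat2 → ℝ}
    (hcont : ContinuousOn (fun u => f (sym u)) offDiag)
    (hf : ∀ u ∈ offDiag, f (sym u) = (if 0 < u.2.1 then k else l) * powerDensity a b c (sym u))
    {S T V : Set ℝ} (hS : MeasurableSet S) (hT : MeasurableSet T) (hV : MeasurableSet V) :
    lawOnD2 f {x | triplet1 x 0 ∈ S ∧ triplet1 x 1 ∈ T ∧ triplet1 x 2 ∈ V} =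
      (∫⁻ s in Set.Ioo (0 : ℝ) 1 ∩ S, ENNReal.ofReal (betaWeight (a + c) (b + c) s)) *
      ((∫⁻ t in Set.Ioo (0 : ℝ) 1 ∩ T, ENNReal.ofReal (betaWeight a (b + c) t)) *
      ∫⁻ v in Set.Ioo (-1 : ℝ) 1 ∩ V,
        ENNReal.ofReal ((if 0 < v then k else l) * thirdWeight b c v)) := by
  rw [lawOnD2_triplet1_mem hcont hS hT hV,
    ← lintegral_mul_const _ (measurable_betaWeight _ _).ennreal_ofReal]
  refine setLIntegral_congr_fun (measurableSet_Ioo.inter hS) fun s hs => ?_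
  rw [← lintegral_mul_const _ (measurable_betaWeight _ _).ennreal_ofReal,
    ← lintegral_const_mul' _ _ ENNReal.ofReal_ne_top]
  refine setLIntegral_congr_fun (measurableSet_Ioo.inter hT) fun t ht => ?_
  rw [← lintegral_const_mul' _ _ ENNReal.ofReal_ne_top,
    ← lintegral_const_mul' _ _ ENNReal.ofReal_ne_top]
  refine setLIntegral_congr_fun_ae (measurableSet_Ioo.inter hV) ?_
  have hne : ∀ᵐ v : ℝ, v ≠ 0 := by simp [ae_iff]
  filter_upwards [hne] with v hv0 hv
  have hsign : 0 < (chart s t v).2.1 ↔ 0 < v := mul_pos_iff_of_pos_left (jac_pos hs.1 ht.1)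
  rw [hf _ (chart_mem_offDiag hs.1 ht.1 hv.1 hv0), mul_left_comm,
    jac_mul_powerDensity_chart a b c hs.1 ht.1 hv.1 hv0,
    ← ENNReal.ofReal_mul (betaWeight_pos _ _ ht.1).le,
    ← ENNReal.ofReal_mul (betaWeight_pos _ _ hs.1).le]
  simp only [hsign]
  congr 1
  ring

/-- The total mass, finite or not, for arbitrary exponents. -/
theorem two_mul_lawOnD2_univ {a b c k l : ℝ} {f : Mat2 → ℝ}
    (hcont : ContinuousOn (fun u => f (sym u)) offDiag)
    (hf : ∀ u ∈ offDiag, f (sym u) = (if 0 < u.2.1 then k else l) * powerDensity a b c (sym u))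
    (hk : 0 ≤ k) (hl : 0 ≤ l) :
    2 * lawOnD2 f Set.univ = betaLIntegral (a + c) (b + c) * (betaLIntegral a (b + c) *
      ((ENNReal.ofReal k + ENNReal.ofReal l) * betaLIntegral c b)) := by
  have h := lawOnD2_triplet1_mem_eq_mul hcont hf MeasurableSet.univ MeasurableSet.univ
    MeasurableSet.univ
  simp only [Set.mem_univ, and_self, Set.ofPred_true, Set.inter_univ] at h
  rw [h, ← two_mul_lintegral_signed_thirdWeight b c hk hl, betaLIntegral, betaLIntegral]
  ring

/-- A law under which the triplet has product form has independent triplet components. -/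
theorem iIndepFun_triplet1_of_eq_mul {Ω : Type*} [MeasurableSpace Ω] {μ : Measure Ω}
    [IsProbabilityMeasure μ] {X : Ω → Mat2} (hX : Measurable X) {m₀ m₁ m₂ : Set ℝ → ENNReal}
    (h : ∀ S T V, MeasurableSet S → MeasurableSet T → MeasurableSet V →
      μ.map X {x | triplet1 x 0 ∈ S ∧ triplet1 x 1 ∈ T ∧ triplet1 x 2 ∈ V} =
        m₀ S * (m₁ T * m₂ V)) :
    iIndepFun (fun (i : Fin 3) (ω : Ω) => triplet1 (X ω) i) μ := by
  have hm : ∀ i : Fin 3, Measurable fun ω => triplet1 (X ω) i := fun i =>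
    (measurable_triplet1 i).comp hX
  have hU : MeasurableSet (Set.univ : Set ℝ) := MeasurableSet.univ
  have hμ : ∀ S T V, MeasurableSet S → MeasurableSet T → MeasurableSet V →
      μ {ω | triplet1 (X ω) 0 ∈ S ∧ triplet1 (X ω) 1 ∈ T ∧ triplet1 (X ω) 2 ∈ V} =
        m₀ S * (m₁ T * m₂ V) := by
    intro S T V hS hT hV
    rw [← h S T V hS hT hV, Measure.map_apply hX (measurableSet_triplet1_mem hS hT hV)]
    rfl
  have hone : m₀ Set.univ * (m₁ Set.univ * m₂ Set.univ) = 1 := by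
    rw [← hμ _ _ _ hU hU hU]
    simp
  rw [iIndepFun_iff_map_fun_eq_pi_map fun i => (hm i).aemeasurable]
  refine (Measure.pi_eq fun S hS => ?_).symm
  rw [Measure.map_apply (measurable_pi_lambda _ hm) (MeasurableSet.univ_pi hS),
    Fin.prod_univ_three, Measure.map_apply (hm 0) (hS 0), Measure.map_apply (hm 1) (hS 1),
    Measure.map_apply (hm 2) (hS 2)]
  have e0 := hμ (S 0) (S 1) (S 2) (hS 0) (hS 1) (hS 2)
  have e1 := hμ (S 0) _ _ (hS 0) hU hU
  have e2 := hμ _ (S 1) _ hU (hS 1) hU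
  have e3 := hμ _ _ (S 2) hU hU (hS 2)
  simp only [Set.mem_univ, and_true, true_and] at e1 e2 e3
  have f0 : (fun ω i => triplet1 (X ω) i) ⁻¹' Set.univ.pi S =
      {ω | triplet1 (X ω) 0 ∈ S 0 ∧ triplet1 (X ω) 1 ∈ S 1 ∧ triplet1 (X ω) 2 ∈ S 2} := by
    ext ω
    simp [Fin.forall_fin_succ]
  have f1 : ∀ i, (fun ω => triplet1 (X ω) i) ⁻¹' S i = {ω | triplet1 (X ω) i ∈ S i} := fun _ => rfl
  rw [f0, f1, f1, f1, e0, e1, e2, e3]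
  calc m₀ (S 0) * (m₁ (S 1) * m₂ (S 2))
      = m₀ (S 0) * (m₁ (S 1) * m₂ (S 2)) *
        ((m₀ Set.univ * (m₁ Set.univ * m₂ Set.univ)) *
          (m₀ Set.univ * (m₁ Set.univ * m₂ Set.univ))) := by rw [hone]; simp
    _ = _ := by ring

/-! ### Normalization and continuity of the family -/

theorem continuousOn_det_rpow (p q : ℝ) :
    ContinuousOn (fun u => (sym u).det ^ p * (1 - sym u).det ^ q) (sym ⁻¹' D2) := by
  simp only [det_sym, det_one_sub_sym]
  refine ContinuousOn.mul ?_ ?_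
  · refine ContinuousOn.rpow_const (by fun_prop) fun u hu => Or.inl ?_
    exact ((sym_mem_D2_iff u).1 hu).1.2.ne'
  · refine ContinuousOn.rpow_const (by fun_prop) fun u hu => Or.inl ?_
    exact ((sym_mem_D2_iff u).1 hu).2.2.ne'

theorem offDiag_subset : offDiag ⊆ sym ⁻¹' D2 := fun u hu => ((mem_offDiag_iff u).1 hu).1

theorem continuousOn_powerDensity (a b c : ℝ) :
    ContinuousOn (fun u => powerDensity a b c (sym u)) offDiag := by
  refine ((continuousOn_det_rpow _ _).mono offDiag_subset).mul ?_
  refine ContinuousOn.rpow_const ?_ fun u hu => Or.inl (abs_pos.2 ((mem_offDiag_iff u).1 hu).2).ne'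
  exact (by fun_prop : Continuous fun u : ℝ × ℝ × ℝ => |u.2.1|).continuousOn

theorem powerDensity_pos {a b c : ℝ} {u : ℝ × ℝ × ℝ} (hu : u ∈ offDiag) :
    0 < powerDensity a b c (sym u) := by
  obtain ⟨h1, h2⟩ := (mem_offDiag_iff u).1 hu
  obtain ⟨⟨-, h3⟩, -, h4⟩ := (sym_mem_D2_iff u).1 h1
  rw [powerDensity, det_sym, det_one_sub_sym]
  have h5 : 0 < |sym u 0 1| := abs_pos.2 h2
  positivity

/-- The normalizing constant of the family. -/
noncomputable def familyNorm (a b c : ℝ) : ℝ := beta a b * beta (a + b) c * beta (a + c) (b + c)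

theorem familyNorm_pos {a b c : ℝ} (ha : 0 < a) (hb : 0 < b) (hc : 0 < c) :
    0 < familyNorm a b c :=
  mul_pos (mul_pos (beta_pos ha hb) (beta_pos (by linarith) hc))
    (beta_pos (by linarith) (by linarith))

theorem familyDensity_eq (a b c : ℝ) (x : Mat2) :
    familyDensity a b c x = powerDensity a b c x / familyNorm a b c := rfl

/-- The normalizing constant as the product of the three one-dimensional beta integrals. -/
theorem beta_mul_beta_mul_beta {a b c : ℝ} (ha : 0 < a) (hb : 0 < b) (hc : 0 < c) :
    beta (a + c) (b + c) * (beta a (b + c) * beta c b) = familyNorm a b c := by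
  have h1 := (Real.Gamma_pos_of_pos (show 0 < b + c by linarith)).ne'
  have h2 := (Real.Gamma_pos_of_pos (show 0 < a + b by linarith)).ne'
  have h3 : beta a (b + c) * beta c b = beta a b * beta (a + b) c := by
    simp only [beta]
    rw [add_comm c b, ← add_assoc]
    field_simp
  rw [h3, familyNorm, mul_comm]

theorem two_mul_lawOnD2_univ_eq {a b c k l : ℝ} {f : Mat2 → ℝ}
    (hcont : ContinuousOn (fun u => f (sym u)) offDiag)
    (hf : ∀ u ∈ offDiag, f (sym u) = (if 0 < u.2.1 then k else l) * powerDensity a b c (sym u))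
    (ha : 0 < a) (hb : 0 < b) (hc : 0 < c) (hk : 0 ≤ k) (hl : 0 ≤ l) :
    2 * lawOnD2 f Set.univ = ENNReal.ofReal ((k + l) * familyNorm a b c) := by
  have hac : 0 < a + c := by linarith
  have hbc : 0 < b + c := by linarith
  have h1 := beta_pos hac hbc
  have h2 := beta_pos ha hbc
  have h3 := beta_pos hc hb
  rw [two_mul_lawOnD2_univ hcont hf hk hl, betaLIntegral_eq hac hbc, betaLIntegral_eq ha hbc,
    betaLIntegral_eq hc hb, ← ENNReal.ofReal_add hk hl, ← ENNReal.ofReal_mul (by positivity),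
    ← ENNReal.ofReal_mul h2.le, ← ENNReal.ofReal_mul h1.le, ← beta_mul_beta_mul_beta ha hb hc]
  congr 1
  ring

theorem lawOnD2_congr {f g : Mat2 → ℝ} (h : ∀ u ∈ offDiag, f (sym u) = g (sym u)) :
    lawOnD2 f = lawOnD2 g := by
  ext A hA
  rw [lawOnD2_apply f hA, lawOnD2_apply g hA]
  refine lintegral_congr fun u => ?_
  by_cases hu : u ∈ offDiag ∩ sym ⁻¹' A
  · rw [Set.indicator_of_mem hu, Set.indicator_of_mem hu, h u hu.1]
  · rw [Set.indicator_of_notMem hu, Set.indicator_of_notMem hu]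

theorem ofReal_eq_of_lawOnD2_eq {f g : Mat2 → ℝ}
    (hf : ContinuousOn (fun u => f (sym u)) offDiag)
    (hg : ContinuousOn (fun u => g (sym u)) offDiag) (h : lawOnD2 f = lawOnD2 g) :
    ∀ u ∈ offDiag, ENNReal.ofReal (f (sym u)) = ENNReal.ofReal (g (sym u)) := by
  have hcont : ∀ {f : Mat2 → ℝ}, ContinuousOn (fun u => f (sym u)) offDiag →
      ContinuousOn (fun u => ENNReal.ofReal (f (sym u))) offDiag := fun hf =>
    ENNReal.continuous_ofReal.comp_continuousOn hf
  have hU := isOpen_offDiag.measurableSet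
  refine Measure.eqOn_open_of_ae_eq (μ := volume) ?_ isOpen_offDiag (hcont hf) (hcont hg)
  refine ae_eq_of_forall_setLIntegral_eq_of_sigmaFinite₀ ((hcont hf).aemeasurable hU)
    ((hcont hg).aemeasurable hU) fun B hB _ => ?_
  have key : ∀ f : Mat2 → ℝ, lawOnD2 f (sym '' B) =
      ∫⁻ u in B, ENNReal.ofReal (f (sym u)) ∂volume.restrict offDiag := by
    intro f
    rw [lawOnD2_apply f (measurableEmbedding_sym.measurableSet_image.2 hB),
      Set.preimage_image_eq _ measurableEmbedding_sym.injective,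
      lintegral_indicator (hU.inter hB), Set.inter_comm, Measure.restrict_restrict hB]
  rw [← key, ← key, h]

/-! ### Characterization of the family, and its independence properties -/

/-- The density is a product of powers on each half of `D₂`; its parameters are positive because
the beta integrals in its total mass are finite. -/
theorem characterization_off_diagonal {Ω : Type*} [MeasurableSpace Ω] (μ : Measure Ω)
    [IsProbabilityMeasure μ] (X : Ω → Mat2) (f : Mat2 → ℝ) (hX : Measurable X)
    (hlaw : μ.map X = lawOnD2 f) (hf : IsC1On f {x | x ∈ D2 ∧ x 0 1 ≠ 0})
    (hpos : ∀ x ∈ D2, x 0 1 ≠ 0 → 0 < f x) (hind : TripletIndep μ X) :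
    ∃ a b c k l : ℝ, 0 < a ∧ 0 < b ∧ 0 < c ∧ 0 < k ∧ 0 < l ∧ k + l = 2 ∧
      ∀ x ∈ D2, (0 < x 0 1 → f x = k * familyDensity a b c x) ∧
        (x 0 1 < 0 → f x = l * familyDensity a b c x) := by
  have hd : DifferentiableOn ℝ (fun u => f (sym u)) offDiag := hf.differentiableOn one_ne_zero
  have hpos' : ∀ u ∈ offDiag, 0 < f (sym u) := fun u hu => hpos _ hu.1 hu.2
  obtain ⟨a, b, c, k, l, hk, hl, hprod⟩ :=
    exists_eq_const_mul_powerDensity hX hlaw hd hpos' hind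
  have hone : lawOnD2 f Set.univ = 1 := by
    rw [← hlaw, Measure.map_apply hX MeasurableSet.univ]
    simp
  have hmass := two_mul_lawOnD2_univ hd.continuousOn hprod hk.le hl.le
  rw [hone, mul_one] at hmass
  have hkl : ENNReal.ofReal k + ENNReal.ofReal l ≠ 0 := by simp [hk]
  have n1 := betaLIntegral_ne_zero (a + c) (b + c)
  have n2 := betaLIntegral_ne_zero a (b + c)
  have n3 := betaLIntegral_ne_zero c b
  have t1 : betaLIntegral a (b + c) ≠ ⊤ := fun h => by
    rw [h, ENNReal.top_mul (mul_ne_zero hkl n3), ENNReal.mul_top n1] at hmass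
    exact ENNReal.ofNat_ne_top hmass
  have t2 : betaLIntegral c b ≠ ⊤ := fun h => by
    rw [h, ENNReal.mul_top hkl, ENNReal.mul_top n2, ENNReal.mul_top n1] at hmass
    exact ENNReal.ofNat_ne_top hmass
  have ha := (pos_of_betaLIntegral_ne_top t1).1
  obtain ⟨hc, hb⟩ := pos_of_betaLIntegral_ne_top t2
  have hZ := familyNorm_pos ha hb hc
  have hmass' := two_mul_lawOnD2_univ_eq hd.continuousOn hprod ha hb hc hk.le hl.le
  rw [hone, mul_one] at hmass'
  have hsum : k * familyNorm a b c + l * familyNorm a b c = 2 := by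
    have h2 : ENNReal.ofReal 2 = ENNReal.ofReal ((k + l) * familyNorm a b c) := by
      rw [← hmass']; simp
    rw [← add_mul]
    exact ((ENNReal.ofReal_eq_ofReal_iff (by norm_num) (by positivity)).1 h2).symm
  refine ⟨a, b, c, k * familyNorm a b c, l * familyNorm a b c, ha, hb, hc, by positivity,
    by positivity, hsum, fun x hx => ?_⟩
  have hx' : x = sym (x 0 0, x 0 1, x 1 1) := exists_eq_sym_of_mem_D2 hx
  have hoff : x 0 1 ≠ 0 → (x 0 0, x 0 1, x 1 1) ∈ offDiag := fun h =>
    (mem_offDiag_iff _).2 ⟨hx' ▸ hx, h⟩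
  constructor
  · intro h
    have := hprod _ (hoff h.ne')
    rw [← hx', if_pos h] at this
    rw [this, familyDensity_eq]
    field_simp
  · intro h
    have := hprod _ (hoff h.ne)
    rw [← hx', if_neg h.not_gt] at this
    rw [this, familyDensity_eq]
    field_simp

/-- A real power has a nonzero limit at `0` only if the exponent vanishes. -/
theorem eq_zero_of_tendsto_rpow {p L : ℝ} (hL : L ≠ 0)
    (h : Filter.Tendsto (fun e : ℝ => e ^ p) (nhdsWithin 0 (Set.Ioi 0)) (nhds L)) : p = 0 := by
  have hhalf : Filter.Tendsto (fun e : ℝ => e / 2) (nhdsWithin 0 (Set.Ioi 0))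
      (nhdsWithin 0 (Set.Ioi 0)) := by
    refine tendsto_nhdsWithin_iff.2 ⟨?_, ?_⟩
    · have : Filter.Tendsto (fun e : ℝ => e / 2) (nhds 0) (nhds (0 / 2)) :=
        (continuous_id.div_const 2).tendsto 0
      rw [zero_div] at this
      exact this.mono_left nhdsWithin_le_nhds
    · filter_upwards [self_mem_nhdsWithin] with e he
      exact half_pos (Set.mem_Ioi.1 he)
  have h1 := h.comp hhalf
  have h2 : Filter.Tendsto (fun e : ℝ => e ^ p / 2 ^ p) (nhdsWithin 0 (Set.Ioi 0))
      (nhds (L / 2 ^ p)) := h.div_const _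
  have h3 : L = L / 2 ^ p := by
    refine tendsto_nhds_unique h1 (h2.congr' ?_)
    filter_upwards [self_mem_nhdsWithin] with e he
    simp only [Function.comp]
    rw [Real.div_rpow (le_of_lt he) (by norm_num)]
  have h4 : (0 : ℝ) < 2 ^ p := by positivity
  have h5 : (2 : ℝ) ^ p = 1 := by
    field_simp at h3
    exact h3
  have h6 := congrArg Real.log h5
  rw [Real.log_rpow two_pos, Real.log_one] at h6
  exact (mul_eq_zero.1 h6).resolve_right (Real.log_pos one_lt_two).ne'

/-- Continuity and positivity on the hyperplane `x₁₂ = 0` leave only `c = 1 / 2` and equal weights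
of the two halves. -/
theorem characterization {Ω : Type*} [MeasurableSpace Ω] (μ : Measure Ω)
    [IsProbabilityMeasure μ] (X : Ω → Mat2) (f : Mat2 → ℝ) (hX : Measurable X)
    (hlaw : μ.map X = lawOnD2 f) (hf : IsC1On f D2) (hpos : ∀ x ∈ D2, 0 < f x)
    (hind : TripletIndep μ X) :
    ∃ a b c : ℝ, 0 < a ∧ 0 < b ∧ 0 < c ∧ ∀ x ∈ D2, f x = familyDensity a b c x := by
  obtain ⟨a, b, c, k, l, ha, hb, hc, hk, hl, hkl, hfam⟩ := characterization_off_diagonal μ X f hX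
    hlaw (ContDiffOn.mono hf fun u hu => hu.1) (fun x hx _ => hpos x hx) hind
  have hZ := familyNorm_pos ha hb hc
  have hfc : ContinuousOn (fun u => f (sym u)) (sym ⁻¹' D2) := ContDiffOn.continuousOn hf
  have hpath : ∀ {x z : ℝ}, Filter.Tendsto (fun e : ℝ => (x, e, z)) (nhds 0) (nhds (x, 0, z)) :=
    fun {x z} => (by fun_prop : Continuous fun e : ℝ => (x, e, z)).tendsto 0
  have hlim : ∀ {g : ℝ × ℝ × ℝ → ℝ}, ContinuousOn g (sym ⁻¹' D2) → ∀ {x z : ℝ},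
      sym (x, 0, z) ∈ D2 → Filter.Tendsto (fun e : ℝ => g (x, e, z)) (nhds 0)
        (nhds (g (x, 0, z))) := fun hg x z hx =>
    (hg.continuousAt (isOpen_preimage_D2.mem_nhds hx)).tendsto.comp hpath
  have hev : ∀ {x z : ℝ}, sym (x, 0, z) ∈ D2 → ∀ᶠ e in nhds (0 : ℝ), sym (x, e, z) ∈ D2 :=
    fun hx => hpath.eventually (isOpen_preimage_D2.mem_nhds hx)
  have hbase : sym (1 / 2, 0, 1 / 2) ∈ D2 := by
    rw [sym_mem_D2_iff]; norm_num
  set M : ℝ × ℝ × ℝ → ℝ := fun u => (sym u).det ^ (a - 1) * (1 - sym u).det ^ (b - 1) with hM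
  have hMc : ContinuousOn M (sym ⁻¹' D2) := continuousOn_det_rpow _ _
  have hMpos : ∀ u, sym u ∈ D2 → 0 < M u := by
    intro u hu
    obtain ⟨⟨-, h3⟩, -, h4⟩ := (sym_mem_D2_iff u).1 hu
    simp only [hM, det_sym, det_one_sub_sym]
    positivity
  have hfM : ∀ x e z : ℝ, sym (x, e, z) ∈ D2 → (0 < e → f (sym (x, e, z)) =
      k * (M (x, e, z) * |e| ^ (2 * c - 1) / familyNorm a b c)) ∧
      (e < 0 → f (sym (x, e, z)) =
      l * (M (x, e, z) * |e| ^ (2 * c - 1) / familyNorm a b c)) := fun x e z h =>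
    hfam (sym (x, e, z)) h
  have hp : 2 * c - 1 = 0 := by
    have h1 := hlim hfc hbase
    have h2 := hlim hMc hbase
    have hM0 := hMpos _ hbase
    refine eq_zero_of_tendsto_rpow (L := f (sym (1 / 2, 0, 1 / 2)) /
      (k * M (1 / 2, 0, 1 / 2) / familyNorm a b c)) ?_ ?_
    · exact (div_pos (hpos _ hbase) (by positivity)).ne'
    · refine (((h1.div ((h2.const_mul k).div_const (familyNorm a b c))
        (by positivity)).mono_left nhdsWithin_le_nhds)).congr' ?_
      filter_upwards [self_mem_nhdsWithin, nhdsWithin_le_nhds (hev hbase)] with e he heD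
      have he' : 0 < e := he
      have hMe := hMpos _ heD
      simp only [Pi.div_apply]
      rw [(hfM _ _ _ heD).1 he, abs_of_pos he']
      field_simp
  -- on `x₁₂ = 0` the density is the limit from both sides
  have hboth : ∀ x z : ℝ, sym (x, 0, z) ∈ D2 →
      f (sym (x, 0, z)) = k * (M (x, 0, z) / familyNorm a b c) ∧
      f (sym (x, 0, z)) = l * (M (x, 0, z) / familyNorm a b c) := by
    intro x z hx
    have h1 := hlim hfc hx
    have h2 : ∀ r : ℝ, Filter.Tendsto (fun e : ℝ => r * (M (x, e, z) / familyNorm a b c)) (nhds 0)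
        (nhds (r * (M (x, 0, z) / familyNorm a b c))) := fun r =>
      ((hlim hMc hx).div_const _).const_mul r
    constructor
    · refine tendsto_nhds_unique (h1.mono_left (nhdsWithin_le_nhds (s := Set.Ioi 0)))
        (((h2 k).mono_left nhdsWithin_le_nhds).congr' ?_)
      filter_upwards [self_mem_nhdsWithin, nhdsWithin_le_nhds (hev hx)] with e he heD
      rw [(hfM _ _ _ heD).1 he, hp, Real.rpow_zero, mul_one]
    · refine tendsto_nhds_unique (h1.mono_left (nhdsWithin_le_nhds (s := Set.Iio 0)))
        (((h2 l).mono_left nhdsWithin_le_nhds).congr' ?_)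
      filter_upwards [self_mem_nhdsWithin, nhdsWithin_le_nhds (hev hx)] with e he heD
      rw [(hfM _ _ _ heD).2 he, hp, Real.rpow_zero, mul_one]
  have hkl' : k = l := by
    have h := hboth _ _ hbase
    have hM0 := hMpos _ hbase
    exact mul_right_cancel₀ (div_pos hM0 hZ).ne' (h.1.symm.trans h.2)
  have hk1 : k = 1 := by linarith
  have hl1 : l = 1 := by linarith
  refine ⟨a, b, c, ha, hb, hc, fun x hx => ?_⟩
  rcases lt_trichotomy (x 0 1) 0 with h | h | h
  · rw [(hfam x hx).2 h, hl1, one_mul]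
  · have hx' : x = sym (x 0 0, 0, x 1 1) := by
      rw [← h]; exact exists_eq_sym_of_mem_D2 hx
    have h1 := (hboth (x 0 0) (x 1 1) (hx' ▸ hx)).1
    rw [hk1, one_mul] at h1
    rw [familyDensity_eq, powerDensity, hp, Real.rpow_zero, mul_one]
    simp only [hM] at h1
    rw [← hx'] at h1
    exact h1
  · rw [(hfam x hx).1 h, hk1, one_mul]

theorem familyDensity_one_half (a b : ℝ) (ha : 0 < a) (hb : 0 < b) (x : Mat2) :
    familyDensity a b (1 / 2) x = matrixBetaDensity (a + 1 / 2) (b + 1 / 2) x := by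
  have hpi : Real.Gamma (1 / 2) = Real.pi ^ ((1 : ℝ) / 2) := by
    rw [Real.Gamma_one_half_eq, Real.sqrt_eq_rpow]
  have hmulti : ∀ p : ℝ, multiGamma 2 p =
      Real.pi ^ ((1 : ℝ) / 2) * (Real.Gamma p * Real.Gamma (p - 1 / 2)) := by
    intro p
    rw [multiGamma, Finset.prod_range_succ, Finset.prod_range_one]
    norm_num
  have e1 : a + 1 / 2 - 3 / 2 = a - 1 := by ring
  have e2 : b + 1 / 2 - 3 / 2 = b - 1 := by ring
  have e3 : (2 : ℝ) * (1 / 2) - 1 = 0 := by norm_num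
  rw [familyDensity, matrixBetaDensity, e1, e2, e3, Real.rpow_zero, mul_one]
  congr 1
  have g1 := (Real.Gamma_pos_of_pos (show 0 < a + b by linarith)).ne'
  have g2 : Real.pi ^ ((1 : ℝ) / 2) ≠ 0 := (Real.rpow_pos_of_pos Real.pi_pos _).ne'
  have i1 : a + 1 / 2 - 1 / 2 = a := by ring
  have i2 : b + 1 / 2 - 1 / 2 = b := by ring
  have i3 : a + 1 / 2 + (b + 1 / 2) = a + b + 1 := by ring
  have i4 : a + b + 1 - 1 / 2 = a + b + 1 / 2 := by ring
  simp only [hmulti, beta, hpi, i1, i2, i3, i4]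
  have g3 := (Real.Gamma_pos_of_pos (show 0 < a + b + 1 by linarith)).ne'
  have g4 := (Real.Gamma_pos_of_pos (show 0 < a + b + 1 / 2 by linarith)).ne'
  field_simp

theorem family_eq_const_mul (a b c : ℝ) (u : ℝ × ℝ × ℝ) :
    familyDensity a b c (sym u) =
      (if 0 < u.2.1 then (familyNorm a b c)⁻¹ else (familyNorm a b c)⁻¹) *
        powerDensity a b c (sym u) := by
  rw [ite_self, familyDensity_eq]
  ring

theorem continuousOn_familyDensity (a b c : ℝ) :
    ContinuousOn (fun u => familyDensity a b c (sym u)) offDiag := by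
  simp only [familyDensity_eq]
  exact (continuousOn_powerDensity a b c).div_const _

theorem isProbabilityMeasure_family {a b c : ℝ} (ha : 0 < a) (hb : 0 < b) (hc : 0 < c) :
    IsProbabilityMeasure (lawOnD2 (familyDensity a b c)) := by
  have hZ := familyNorm_pos ha hb hc
  have h := two_mul_lawOnD2_univ_eq (continuousOn_familyDensity a b c)
    (fun u _ => family_eq_const_mul a b c u) ha hb hc (by positivity) (by positivity)
  have e : ((familyNorm a b c)⁻¹ + (familyNorm a b c)⁻¹) * familyNorm a b c = 2 := by
    field_simp; norm_num
  rw [e, show ENNReal.ofReal 2 = 2 * 1 by simp] at h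
  exact ⟨(ENNReal.mul_right_inj two_ne_zero ENNReal.ofNat_ne_top).1 h⟩

theorem tripletIndep_family {a b c : ℝ} (ha : 0 < a) (hb : 0 < b) (hc : 0 < c) :
    TripletIndep (lawOnD2 (familyDensity a b c)) (fun x => x) := by
  have := isProbabilityMeasure_family ha hb hc
  have hgen : ∀ X : Mat2 → Mat2, Measurable X →
      (lawOnD2 (familyDensity a b c)).map X = lawOnD2 (familyDensity a b c) →
      iIndepFun (fun (i : Fin 3) (x : Mat2) => triplet1 (X x) i)
        (lawOnD2 (familyDensity a b c)) := by
    intro X hX hlaw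
    refine iIndepFun_triplet1_of_eq_mul hX
      (m₀ := fun S => ∫⁻ s in Set.Ioo (0 : ℝ) 1 ∩ S,
        ENNReal.ofReal (betaWeight (a + c) (b + c) s))
      (m₁ := fun T => ∫⁻ t in Set.Ioo (0 : ℝ) 1 ∩ T, ENNReal.ofReal (betaWeight a (b + c) t))
      (m₂ := fun V => ∫⁻ v in Set.Ioo (-1 : ℝ) 1 ∩ V, ENNReal.ofReal
        ((if 0 < v then (familyNorm a b c)⁻¹ else (familyNorm a b c)⁻¹) * thirdWeight b c v))
      fun S T V hS hT hV => ?_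
    rw [hlaw]
    exact lawOnD2_triplet1_mem_eq_mul (continuousOn_familyDensity a b c)
      (fun u _ => family_eq_const_mul a b c u) hS hT hV
  refine ⟨hgen _ measurable_id Measure.map_id, ?_⟩
  simp only [← triplet1_swapDiag]
  refine hgen _ measurable_swapDiag ?_
  rw [lawOnD2_map_swapDiag]
  refine lawOnD2_congr fun ⟨x, y, z⟩ _ => ?_
  rw [swapDiag_sym]
  simp only [familyDensity, det_sym, det_one_sub_sym]
  rw [mul_comm z x, mul_comm (1 - z) (1 - x)]
  rfl

/-- Two matrices with the same `det x` and `det (1 - x)` but different `x₁₂` distinguish the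
family from the matrix beta laws unless `c = 1 / 2`. -/
theorem eq_one_half_of_law_eq {a b c p q : ℝ} (ha : 0 < a) (hb : 0 < b) (hc : 0 < c)
    (h : lawOnD2 (familyDensity a b c) = lawOnD2 (matrixBetaDensity p q)) : c = 1 / 2 := by
  have hcont : ContinuousOn (fun u => matrixBetaDensity p q (sym u)) offDiag :=
    ((continuousOn_det_rpow _ _).mono offDiag_subset).div_const _
  have heq := ofReal_eq_of_lawOnD2_eq (continuousOn_familyDensity a b c) hcont h
  have m1 : ((13 / 20, 1 / 5, 7 / 20) : ℝ × ℝ × ℝ) ∈ offDiag := by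
    rw [mem_offDiag_iff, sym_mem_D2_iff]; norm_num
  have m2 : ((7 / 10, 3 / 20, 3 / 10) : ℝ × ℝ × ℝ) ∈ offDiag := by
    rw [mem_offDiag_iff, sym_mem_D2_iff]; norm_num
  have d1 : (sym (13 / 20, 1 / 5, 7 / 20)).det = 3 / 16 := by rw [det_sym]; norm_num
  have d2 : (sym (7 / 10, 3 / 20, 3 / 10)).det = 3 / 16 := by rw [det_sym]; norm_num
  have d1' : (1 - sym (13 / 20, 1 / 5, 7 / 20)).det = 3 / 16 := by
    rw [det_one_sub_sym]; norm_num
  have d2' : (1 - sym (7 / 10, 3 / 20, 3 / 10)).det = 3 / 16 := by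
    rw [det_one_sub_sym]; norm_num
  have hZ := familyNorm_pos ha hb hc
  have e1 := heq _ m1
  rw [show matrixBetaDensity p q (sym (13 / 20, 1 / 5, 7 / 20)) =
    matrixBetaDensity p q (sym (7 / 10, 3 / 20, 3 / 10)) by
      simp only [matrixBetaDensity, d1, d2, d1', d2'], ← heq _ m2, familyDensity_eq,
    familyDensity_eq, ENNReal.ofReal_eq_ofReal_iff (div_pos (powerDensity_pos m1) hZ).le
      (div_pos (powerDensity_pos m2) hZ).le, div_left_inj' hZ.ne', powerDensity, powerDensity,
    d1, d2, d1', d2'] at e1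
  have e2 := mul_left_cancel₀ (by positivity) e1
  have y1 : |sym (13 / 20, 1 / 5, 7 / 20) 0 1| = 1 / 5 := by
    simp [sym]
  have y2 : |sym (7 / 10, 3 / 20, 3 / 10) 0 1| = 3 / 20 := by
    rw [abs_of_pos] <;> simp [sym]
  rw [y1, y2] at e2
  have l2 := congrArg Real.log e2
  rw [Real.log_rpow (by norm_num), Real.log_rpow (by norm_num)] at l2
  have hlt : Real.log (3 / 20) < Real.log (1 / 5) := Real.log_lt_log (by norm_num) (by norm_num)
  have h0 : (2 * c - 1) * (Real.log (1 / 5) - Real.log (3 / 20)) = 0 := by linarith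
  have := (mul_eq_zero.1 h0).resolve_right (by linarith)
  linarith

end KshirsagarTan

open KshirsagarTan in
theorem theorem4 :
    -- a density that is C¹ and strictly positive on all of `D₂`
    (∀ {Ω : Type*} [MeasurableSpace Ω] (μ : Measure Ω) [IsProbabilityMeasure μ]
      (X : Ω → Mat2) (f : Mat2 → ℝ), Measurable X → μ.map X = lawOnD2 f →
      IsC1On f D2 → (∀ x ∈ D2, 0 < f x) → TripletIndep μ X →
      ∃ a b c : ℝ, 0 < a ∧ 0 < b ∧ 0 < c ∧ ∀ x ∈ D2, f x = familyDensity a b c x) ∧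
    -- the same with the regularity and positivity required only where `x₁₂ ≠ 0`
    (∀ {Ω : Type*} [MeasurableSpace Ω] (μ : Measure Ω) [IsProbabilityMeasure μ]
      (X : Ω → Mat2) (f : Mat2 → ℝ), Measurable X → μ.map X = lawOnD2 f →
      IsC1On f {x | x ∈ D2 ∧ x 0 1 ≠ 0} → (∀ x ∈ D2, x 0 1 ≠ 0 → 0 < f x) →
      TripletIndep μ X →
      ∃ a b c k l : ℝ, 0 < a ∧ 0 < b ∧ 0 < c ∧ 0 < k ∧ 0 < l ∧ k + l = 2 ∧
        ∀ x ∈ D2, (0 < x 0 1 → f x = k * familyDensity a b c x) ∧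
          (x 0 1 < 0 → f x = l * familyDensity a b c x)) ∧
    -- the family consists of probability laws with both independences, and contains the
    -- matrix beta laws exactly as its members with `c = 1/2`
    (∀ a b c : ℝ, 0 < a → 0 < b → 0 < c →
      IsProbabilityMeasure (lawOnD2 (familyDensity a b c)) ∧
      TripletIndep (lawOnD2 (familyDensity a b c)) (fun x => x) ∧
      (c = 1 / 2 → ∀ x ∈ D2,
        familyDensity a b c x = matrixBetaDensity (a + 1 / 2) (b + 1 / 2) x) ∧
      ((∃ p q : ℝ, 1 / 2 < p ∧ 1 / 2 < q ∧
        lawOnD2 (familyDensity a b c) = lawOnD2 (matrixBetaDensity p q)) ↔ c = 1 / 2)) := by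
  refine ⟨fun μ _ X f hX hlaw hf hpos hind => characterization μ X f hX hlaw hf hpos hind,
    fun μ _ X f hX hlaw hf hpos hind =>
      characterization_off_diagonal μ X f hX hlaw hf hpos hind,
    fun a b c ha hb hc => ⟨isProbabilityMeasure_family ha hb hc, tripletIndep_family ha hb hc,
      ?_, ?_, ?_⟩⟩
  · rintro rfl x -
    exact familyDensity_one_half a b ha hb x
  · rintro ⟨p, q, -, -, h⟩
    exact eq_one_half_of_law_eq ha hb hc h
  · rintro rfl
    exact ⟨a + 1 / 2, b + 1 / 2, by linarith, by linarith,
      lawOnD2_congr fun u _ => familyDensity_one_half a b ha hb (sym u)⟩
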